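/- **Theorem.** Let $\mathbb E$ be the Engel group, i.e. the connected, simply connected nilpotent Lie group whose Lie algebra has a basis $(X_1,X_2,X_3,X_4)$ with only nontrivial brackets $[X_1,X_2]=X_3$ and $[X_1,X_3]=X_4$. Identify $\mathbb E$ with $\mathbb R^4$ through exponential coordinates with respect to this basis, the group operation being given by the Baker–Campbell–Hausdorff formula. Let $\delta_r(x)=(rx_1,rx_2,r^2x_3,r^3x_4)$, $r>0$, be the dilations, and let $d$ be a homogeneous distance on $\mathbb E$: a continuous distance with $d(zx,zy)=d(x,y)$ and $d(\delta_r x,\delta_r y)=r\,d(x,y)$ for all $x,y,z\in\mathbb E$, $r>0$. For $N\in\mathbb N$ let $\mathcal S^N$ be the $N$-dimensional spherical measure of $d$, $$\mathcal S^N(A)=\sup_{\delta>0}\ \inf\Big\{\sum_{j=0}^\infty\Big(\frac{\operatorname{diam} B_j}{2}\Big)^N:\ A\subset\bigcup_{j} B_j,\ \operatorname{diam}B_j\le\delta,\ B_j \text{ closed $d$-balls of positive radius}\Big\}.$$ The left invariant vector fields $X_1,X_2,X_3,X_4$ have degrees $1,1,2,3$, the bivector $X_i\wedge X_j$ ($i<j$)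 has degree equal to the sum of the degrees of $X_i$ and $X_j$, and a nonzero bivector $\sum_{i<j}c_{ij}X_i\wedge X_j$ has degree equal to the largest degree of the $X_i\wedge X_j$ with $c_{ij}\neq0$. For a two-dimensional $C^1$ submanifold $\Sigma\subset\mathbb E$ and $p\in\Sigma$, let $d_\Sigma(p)$ be the degree of $Z_1\wedge Z_2$, where $Z_1,Z_2$ are left invariant vector fields such that $(Z_1(p),Z_2(p))$ is a basis of $T_p\Sigma$ (this does not depend on the basis), let $d(\Sigma)=\max_{p\in\Sigma}d_\Sigma(p)$, and let $C(\Sigma)=\{p\in\Sigma: d_\Sigma(p)<d(\Sigma)\}$. Let $\Sigma\subset\mathbb E$ be a $2$-dimensional (embedded) submanifold of class $C^{1,\alpha}$ with $2\le d(\Sigma)\le 4$, where $$\frac{d(\Sigma)-2}{d(\Sigma)}<\alpha\le1 .$$ Then $\mathcal S^{d(\Sigma)}(C(\Sigma))=0$. -/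

import Mathlib

open scoped NNReal ENNReal Topology
open Set Filter

noncomputable section

/-- The Engel group in graded coordinates `x = (x₁, x₂, x₃, x₄)` (indexed by `0, 1, 2, 3`), that is,
the Engel Lie algebra identified with its simply connected Lie group through the exponential map.
The vector space structure and the (Euclidean) topology are those of `ℝ⁴`. -/
def EngelGroup : Type := Fin 4 → ℝ

namespace EngelGroup

instance : NormedAddCommGroup EngelGroup := inferInstanceAs (NormedAddCommGroup (Fin 4 → ℝ))

instance : NormedSpace ℝ EngelGroup := inferInstanceAs (NormedSpace ℝ (Fin 4 → ℝ))

/-- The graded basis `(e₁, e₂, e₃, e₄)`. -/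
def basis : Module.Basis (Fin 4) ℝ EngelGroup := Pi.basisFun ℝ (Fin 4)

/-- The Engel Lie bracket: `[e₁, e₂] = e₃`, `[e₁, e₃] = e₄`, all other brackets of basis vectors
with indices `i < j` vanish. -/
instance : Bracket EngelGroup EngelGroup :=
  ⟨fun x y => ![0, 0, x 0 * y 1 - x 1 * y 0, x 0 * y 2 - x 2 * y 0]⟩

@[ext] theorem ext {x y : EngelGroup} (h₀ : x 0 = y 0) (h₁ : x 1 = y 1) (h₂ : x 2 = y 2)
    (h₃ : x 3 = y 3) : x = y := by
  funext i
  fin_cases i <;> assumption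

@[simp] theorem add_apply (x y : EngelGroup) (i : Fin 4) : (x + y) i = x i + y i := rfl

@[simp] theorem neg_apply (x : EngelGroup) (i : Fin 4) : (-x) i = -x i := rfl

@[simp] theorem zero_apply (i : Fin 4) : (0 : EngelGroup) i = 0 := rfl

@[simp] theorem smul_apply (c : ℝ) (x : EngelGroup) (i : Fin 4) : (c • x) i = c * x i := rfl

@[simp] theorem bracket_zero (x y : EngelGroup) : ⁅x, y⁆ 0 = 0 := rfl

@[simp] theorem bracket_one (x y : EngelGroup) : ⁅x, y⁆ 1 = 0 := rfl

@[simp] theorem bracket_two (x y : EngelGroup) : ⁅x, y⁆ 2 = x 0 * y 1 - x 1 * y 0 := rfl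

@[simp] theorem bracket_three (x y : EngelGroup) : ⁅x, y⁆ 3 = x 0 * y 2 - x 2 * y 0 := rfl

instance : LieRing EngelGroup where
  add_lie x y z := by ext <;> simp <;> ring
  lie_add x y z := by ext <;> simp <;> ring
  lie_self x := by ext <;> simp <;> ring
  leibniz_lie x y z := by ext <;> simp; ring

instance : LieAlgebra ℝ EngelGroup where
  lie_smul c x y := by ext <;> simp <;> ring

/-- The group operation is the Baker–Campbell–Hausdorff formula, truncated at step three. -/
instance : Mul EngelGroup :=
  ⟨fun x y => x + y + (1 / 2 : ℝ) • ⁅x, y⁆ + (1 / 12 : ℝ) • (⁅x, ⁅x, y⁆⁆ + ⁅y, ⁅y, x⁆⁆)⟩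

theorem mul_def (x y : EngelGroup) :
    x * y = x + y + (1 / 2 : ℝ) • ⁅x, y⁆ + (1 / 12 : ℝ) • (⁅x, ⁅x, y⁆⁆ + ⁅y, ⁅y, x⁆⁆) := rfl

instance : One EngelGroup := ⟨0⟩

instance : Inv EngelGroup := ⟨fun x => -x⟩

theorem one_def : (1 : EngelGroup) = 0 := rfl

theorem inv_def (x : EngelGroup) : x⁻¹ = -x := rfl

instance : Group EngelGroup :=
  Group.ofLeftAxioms
    (fun x y z => by
      ext <;> simp only [mul_def, add_apply, smul_apply, bracket_zero, bracket_one, bracket_two,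
        bracket_three] <;> ring)
    (fun x => by
      ext <;> simp [mul_def, one_def])
    (fun x => by
      ext <;> simp only [mul_def, inv_def, one_def, add_apply, smul_apply, neg_apply, zero_apply,
        bracket_zero, bracket_one, bracket_two, bracket_three] <;> ring)

/-- The degrees of the graded coordinates: `e₁, e₂` have degree one, `e₃` has degree two and `e₄`
has degree three. -/
def weight : Fin 4 → ℕ := ![1, 1, 2, 3]

/-- The intrinsic dilations `δ_r`. -/
def dilation (r : ℝ) (x : EngelGroup) : EngelGroup := fun i => r ^ weight i * x i

/-- Homogeneous distances: continuous distances that are left invariant and `1`-homogeneous with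
respect to dilations. -/
structure IsHomogeneousDist (d : EngelGroup → EngelGroup → ℝ) : Prop where
  eq_zero_iff : ∀ x y, d x y = 0 ↔ x = y
  symm : ∀ x y, d x y = d y x
  triangle : ∀ x y z, d x z ≤ d x y + d y z
  continuous : Continuous fun q : EngelGroup × EngelGroup => d q.1 q.2
  left_invariant : ∀ z x y, d (z * x) (z * y) = d x y
  homogeneous : ∀ r : ℝ, 0 < r → ∀ x y, d (dilation r x) (dilation r y) = r * d x y

/-- The closed ball with center `x` and radius `r` for the distance `d`. -/
def closedBall (d : EngelGroup → EngelGroup → ℝ) (x : EngelGroup) (r : ℝ) : Set EngelGroup :=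
  {y | d x y ≤ r}

/-- The diameter, with respect to `d`, of a subset. -/
def diam (d : EngelGroup → EngelGroup → ℝ) (S : Set EngelGroup) : ℝ≥0∞ :=
  ⨆ x ∈ S, ⨆ y ∈ S, ENNReal.ofReal (d x y)

/-- The size `δ` approximation of the `N`-dimensional spherical measure: the infimum of
`∑ⱼ (diam Bⱼ / 2) ^ N` over all sequences of closed balls `Bⱼ` of positive radius and diameter at
most `δ` that cover `A`. -/
def sphericalPre (d : EngelGroup → EngelGroup → ℝ) (N : ℕ) (δ : ℝ≥0∞) (A : Set EngelGroup) :
    ℝ≥0∞ :=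
  ⨅ (c : ℕ → EngelGroup) (r : ℕ → ℝ) (_ : ∀ j, 0 < r j)
    (_ : ∀ j, diam d (closedBall d (c j) (r j)) ≤ δ) (_ : A ⊆ ⋃ j, closedBall d (c j) (r j)),
    ∑' j, (diam d (closedBall d (c j) (r j)) / 2) ^ N

/-- The `N`-dimensional spherical measure of a set, with respect to the distance `d`. -/
def sphericalMeasure (d : EngelGroup → EngelGroup → ℝ) (N : ℕ) (A : Set EngelGroup) : ℝ≥0∞ :=
  ⨆ (δ : ℝ≥0∞) (_ : 0 < δ), sphericalPre d N δ A

/-- The value at `p` of the left invariant vector field whose value at the identity is `Z`, that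
is, the differential at the identity of the left translation by `p`, applied to `Z`. -/
def leftField (Z p : EngelGroup) : EngelGroup :=
  fderiv ℝ (fun q : EngelGroup => p * q) 1 Z

/-- The degree of a left invariant `k`-vector: the largest degree `d_{i₁} + ⋯ + d_{i_k}` of a basis
vector `X_{i₁} ∧ ⋯ ∧ X_{i_k}` on which it has a nonzero coefficient. -/
def vectorDegree {k : ℕ} (ξ : ⋀[ℝ]^k EngelGroup) : ℕ :=
  ((basis.exteriorPower k).repr ξ).support.sup fun I => ∑ i ∈ (I : Finset (Fin 4)), weight i

/-- `φ` is a local parametrization of class `C^{1,α}` of `S`, defined on the open set `U` of the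
plane: an immersion, with locally `α`-Hölder continuous differential, that is a homeomorphism onto a
relatively open subset of `S`. -/
structure IsLocalParam (α : ℝ≥0) (S : Set EngelGroup) (U : Set (EuclideanSpace ℝ (Fin 2)))
    (φ : EuclideanSpace ℝ (Fin 2) → EngelGroup) : Prop where
  isOpen : IsOpen U
  contDiffOn : ContDiffOn ℝ 1 φ U
  locally_holder : ∀ u ∈ U, ∃ W ∈ 𝓝 u, ∃ C : ℝ≥0, HolderOnWith C α (fderiv ℝ φ) W
  immersion : ∀ u ∈ U, Function.Injective (fderiv ℝ φ u)
  isEmbedding : Topology.IsEmbedding (U.domRestrict φ)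
  image_eq : ∃ V : Set EngelGroup, IsOpen V ∧ φ '' U = S ∩ V

/-- Two-dimensional (embedded) submanifolds of class `C^{1,α}`. -/
def IsC1HolderSurface (α : ℝ≥0) (S : Set EngelGroup) : Prop :=
  ∀ p ∈ S, ∃ (U : Set (EuclideanSpace ℝ (Fin 2))) (φ : EuclideanSpace ℝ (Fin 2) → EngelGroup),
    IsLocalParam α S U φ ∧ p ∈ φ '' U

/-- The tangent space of `S` at `p`: velocities at `p` of curves lying in `S`. -/
def tangentSpace (S : Set EngelGroup) (p : EngelGroup) : Set EngelGroup :=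
  {v | ∃ γ : ℝ → EngelGroup, γ 0 = p ∧ (∀ᶠ t in 𝓝 0, γ t ∈ S) ∧ HasDerivAt γ v 0}

/-- The pointwise degree of a surface `S` at `p`: the degree of `Z₁ ∧ Z₂`, where the left invariant
fields `Z₁`, `Z₂` are such that `(Z₁(p), Z₂(p))` is a basis of the tangent space of `S` at `p`. On a
surface all such bases give the same value. -/
def pointDegree (S : Set EngelGroup) (p : EngelGroup) : ℕ :=
  sSup {n | ∃ Z : Fin 2 → EngelGroup, (∀ i, leftField (Z i) p ∈ tangentSpace S p) ∧
    LinearIndependent ℝ (fun i => leftField (Z i) p) ∧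
    vectorDegree (exteriorPower.ιMulti ℝ 2 Z) = n}

/-- The degree of a surface: the maximum of the pointwise degrees. -/
def degree (S : Set EngelGroup) : ℕ := sSup (pointDegree S '' S)

/-- The set `C(S)` of points of `S` whose degree is less than the degree of `S`. -/
def lowDegreeSet (S : Set EngelGroup) : Set EngelGroup := {p ∈ S | pointDegree S p < degree S}

end EngelGroup

end

noncomputable section

namespace EngelGroup

/-! ### Covers by balls and the spherical measure -/

variable {d : EngelGroup → EngelGroup → ℝ}

/-! Write `N` for the degree of the surface. In a local parametrization `φ`, suppose that the
preimage of every ball of radius `K r` centered on the low degree set has area at least `m r`. A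
packing argument then covers that set by at most a constant times `1 / m r` balls of radius `2 K r`,
so it is negligible once `r ^ N / m r → 0` (`hasSmallCovers_of_measure`). A point `φ (u + h)` lies
in such a ball around `p = φ u` when the coordinates of `p⁻¹ * φ (u + h)` are `O(r)`, `O(r)`,
`O(r²)`, `O(r³)`. The tangent plane at `p`, read in the left invariant frame, controls them.

Degree 4, point of degree at most 3: the tangent plane has no `X₄` component, so the last coordinate
is `O(‖h‖^(1+α))`, while the third is a linear form `ℓ h` up to the same error. The conditions `‖h‖
≤ r^e`, `e = 3/(1+α)`, and `|ℓ h| ≤ r²` suffice. They cut out a slab of area at least of order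
`r^(e+2)`, and `e < 2` exactly when `α > 1/2`.

Degree 3, point of degree at most 2: the `X₃` component vanishes at `p`, and the `X₄` component
vanishes on the whole surface. Integrating the latter along a segment improves the last coordinate
to `O(‖h‖^(2+α))`. The full disc of radius `r^e`, `e = 2/(1+α)`, is admissible, and `2e < 3` exactly
when `α > 1/3`.

Degree 2: every point has degree at least 2, so the low degree set is empty. -/

theorem IsHomogeneousDist.self_eq_zero (hd : IsHomogeneousDist d) (x : EngelGroup) : d x x = 0 :=
  (hd.eq_zero_iff x x).2 rfl

theorem IsHomogeneousDist.nonneg (hd : IsHomogeneousDist d) (x y : EngelGroup) : 0 ≤ d x y := by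
  have h := hd.triangle x y x
  rw [hd.self_eq_zero, hd.symm y x] at h
  linarith

theorem diam_closedBall_le (hd : IsHomogeneousDist d) (x : EngelGroup) (r : ℝ) :
    diam d (closedBall d x r) ≤ 2 * ENNReal.ofReal r := by
  refine iSup₂_le fun y hy => iSup₂_le fun z hz => ?_
  have hy' : d x y ≤ r := hy
  have hz' : d x z ≤ r := hz
  have h := hd.triangle y x z
  rw [hd.symm y x] at h
  calc ENNReal.ofReal (d y z) ≤ ENNReal.ofReal (2 * r) := ENNReal.ofReal_le_ofReal (by linarith)
    _ = 2 * ENNReal.ofReal r := by rw [ENNReal.ofReal_mul (by norm_num)]; simp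

/-- The set `A` has countable covers by closed balls for which the sum of the `N`-th powers of the
radii is arbitrarily small. -/
def HasSmallCovers (d : EngelGroup → EngelGroup → ℝ) (N : ℕ) (A : Set EngelGroup) : Prop :=
  ∀ ε : ℝ≥0∞, ε ≠ 0 → ∃ (ι : Type) (_ : Countable ι) (c : ι → EngelGroup) (r : ι → ℝ),
    (∀ j, 0 < r j) ∧ A ⊆ ⋃ j, closedBall d (c j) (r j) ∧ ∑' j, ENNReal.ofReal (r j) ^ N ≤ ε

theorem hasSmallCovers_empty (N : ℕ) : HasSmallCovers d N ∅ := fun ε _ =>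
  ⟨Empty, inferInstance, fun j => j.elim, fun j => j.elim, fun j => j.elim, by simp, by simp⟩

theorem HasSmallCovers.mono {N : ℕ} {A B : Set EngelGroup} (h : HasSmallCovers d N B)
    (hAB : A ⊆ B) : HasSmallCovers d N A := fun ε hε => by
  obtain ⟨ι, hι, c, r, hr, hc, hs⟩ := h ε hε
  exact ⟨ι, hι, c, r, hr, hAB.trans hc, hs⟩

theorem hasSmallCovers_iUnion {N : ℕ} {κ : Type} [Countable κ] {A : κ → Set EngelGroup}
    (h : ∀ k, HasSmallCovers d N (A k)) : HasSmallCovers d N (⋃ k, A k) := by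
  intro ε hε
  obtain ⟨ε', hε', hsum⟩ := ENNReal.exists_pos_sum_of_countable' hε κ
  choose ι hι c r hr hc hs using fun k => h k (ε' k) (hε' k).ne'
  refine ⟨Σ k, ι k, inferInstance, fun j => c j.1 j.2, fun j => r j.1 j.2, fun j => hr _ _, ?_, ?_⟩
  · refine iUnion_subset fun k x hx => ?_
    obtain ⟨i, hi⟩ := mem_iUnion.1 (hc k hx)
    exact mem_iUnion.2 ⟨⟨k, i⟩, hi⟩
  · exact (ENNReal.tsum_sigma fun k i => ENNReal.ofReal (r k i) ^ N).trans_le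
      ((ENNReal.tsum_le_tsum hs).trans hsum.le)

/-- The index type may be finite or empty, whereas the spherical measure asks for a sequence of
balls of positive radius. Half of `ε` is reserved for padding by tiny balls. -/
theorem HasSmallCovers.exists_nat {N : ℕ} (hN : N ≠ 0) {A : Set EngelGroup}
    (h : HasSmallCovers d N A) {ε : ℝ≥0∞} (hε : ε ≠ 0) :
    ∃ (c : ℕ → EngelGroup) (r : ℕ → ℝ), (∀ j, 0 < r j) ∧ A ⊆ ⋃ j, closedBall d (c j) (r j) ∧
      ∑' j, ENNReal.ofReal (r j) ^ N ≤ ε := by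
  have hε2 : ε / 2 ≠ 0 := (ENNReal.half_pos hε).ne'
  obtain ⟨ι, hι, c, r, hr, hc, hs⟩ := h (ε / 2) hε2
  obtain ⟨ρ, hρ, hρs⟩ := ENNReal.exists_pos_sum_of_countable hε2 ℕ
  obtain ⟨e⟩ : Nonempty (ℕ ≃ ι ⊕ ℕ) := nonempty_equiv_of_countable
  refine ⟨fun j => Sum.elim c (fun _ => 1) (e j),
    fun j => Sum.elim r (fun k => min 1 (ρ k : ℝ)) (e j), fun j => ?_, fun x hx => ?_, ?_⟩
  · change 0 < Sum.elim r (fun k => min 1 (ρ k : ℝ)) (e j)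
    rcases e j with i | k
    · exact hr i
    · exact lt_min one_pos (NNReal.coe_pos.2 (hρ k))
  · obtain ⟨i, hi⟩ := mem_iUnion.1 (hc hx)
    exact mem_iUnion.2 ⟨e.symm (Sum.inl i), by simpa using hi⟩
  · rw [e.tsum_eq fun s => ENNReal.ofReal (Sum.elim r (fun k => min 1 (ρ k : ℝ)) s) ^ N,
      ENNReal.summable.tsum_sum (f := fun s =>
        ENNReal.ofReal (Sum.elim r (fun k => min 1 (ρ k : ℝ)) s) ^ N) ENNReal.summable,
      ← ENNReal.add_halves ε]
    refine add_le_add hs ((ENNReal.tsum_le_tsum fun k => ?_).trans hρs.le)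
    have h0 : 0 ≤ min 1 (ρ k : ℝ) := le_min zero_le_one (ρ k).2
    rw [Sum.elim_inr, ← ENNReal.ofReal_pow h0, ← ENNReal.ofReal_coe_nnreal]
    exact ENNReal.ofReal_le_ofReal
      ((pow_le_of_le_one h0 (min_le_left _ _) hN).trans (min_le_right _ _))

/-- No bound on the mesh is needed in `HasSmallCovers`: a sum at most `(δ / 2) ^ N` forces each
radius to be at most `δ / 2`. -/
theorem HasSmallCovers.sphericalMeasure_eq_zero (hd : IsHomogeneousDist d) {N : ℕ} (hN : N ≠ 0)
    {A : Set EngelGroup} (h : HasSmallCovers d N A) : sphericalMeasure d N A = 0 := by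
  refine le_antisymm (iSup₂_le fun δ hδ => le_of_forall_gt fun ε hε => ?_) zero_le
  obtain ⟨ε₁, hε₁, hεε⟩ := exists_between hε
  have hδ2 : (δ / 2) ^ N ≠ 0 := pow_ne_zero _ (ENNReal.half_pos hδ.ne').ne'
  have hmin : min ε₁ ((δ / 2) ^ N) ≠ 0 := (lt_min hε₁ (pos_iff_ne_zero.2 hδ2)).ne'
  obtain ⟨c, r, hr, hc, hs⟩ := h.exists_nat hN hmin
  refine lt_of_le_of_lt ?_ hεε
  have hball : ∀ j, diam d (closedBall d (c j) (r j)) / 2 ≤ ENNReal.ofReal (r j) := fun j => by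
    refine ENNReal.div_le_of_le_mul ?_
    rw [mul_comm]
    exact diam_closedBall_le hd _ _
  have hrad : ∀ j, ENNReal.ofReal (r j) ≤ δ / 2 := fun j => by
    refine (ENNReal.pow_le_pow_left_iff hN).1 ?_
    exact (ENNReal.le_tsum j).trans (hs.trans (min_le_right _ _))
  refine iInf_le_of_le c (iInf_le_of_le r (iInf_le_of_le hr (iInf_le_of_le (fun j => ?_)
    (iInf_le_of_le hc ?_))))
  · refine (diam_closedBall_le hd _ _).trans ?_
    calc 2 * ENNReal.ofReal (r j) ≤ 2 * (δ / 2) := by gcongr; exact hrad j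
      _ = δ := ENNReal.mul_div_cancel two_ne_zero ENNReal.ofNat_ne_top
  · exact (ENNReal.tsum_le_tsum fun j => by gcongr; exact hball j).trans (hs.trans (min_le_left _ _))

/-! ### Packing: from area bounds to small covers -/

open MeasureTheory

/-- A separated finite subset of `A` has bounded cardinality if the preimages of balls centered on
`A` have measure bounded from below. -/
theorem card_mul_le_measure (hd : IsHomogeneousDist d) {X : Type*} [MeasurableSpace X]
    (μ : Measure X) {f : X → EngelGroup} {W : Set X} {r : ℝ} {m : ℝ≥0∞} {t : Finset EngelGroup}
    (hmeas : ∀ p, MeasurableSet {u ∈ W | d p (f u) ≤ r})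
    (hm : ∀ p ∈ t, m ≤ μ {u ∈ W | d p (f u) ≤ r})
    (ht : (t : Set EngelGroup).Pairwise fun p q => 2 * r < d p q) : t.card * m ≤ μ W := by
  calc (t.card : ℝ≥0∞) * m = ∑ p ∈ t, m := by simp
    _ ≤ ∑ p ∈ t, μ {u ∈ W | d p (f u) ≤ r} := Finset.sum_le_sum hm
    _ = μ (⋃ p ∈ t, {u ∈ W | d p (f u) ≤ r}) := by
      refine (measure_biUnion_finset (fun p hp q hq hpq => ?_) fun p _ => hmeas p).symm
      refine Set.disjoint_left.2 fun u hu hu' => ?_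
      have h := hd.triangle p (f u) q
      rw [hd.symm (f u) q] at h
      have := ht hp hq hpq
      linarith [hu.2, hu'.2]
    _ ≤ μ W := measure_mono (iUnion₂_subset fun p _ => sep_subset _ _)

/-- A maximal separated subset gives a cover with a controlled number of balls. -/
theorem exists_finset_cover (hd : IsHomogeneousDist d) {X : Type*} [MeasurableSpace X]
    (μ : Measure X) {f : X → EngelGroup} {W : Set X} {A : Set EngelGroup} {r V m : ℝ}
    (hr : 0 < r) (hm0 : 0 < m) (hV : 0 ≤ V) (hW : μ W ≤ ENNReal.ofReal V)
    (hmeas : ∀ p, MeasurableSet {u ∈ W | d p (f u) ≤ r})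
    (hm : ∀ p ∈ A, ENNReal.ofReal m ≤ μ {u ∈ W | d p (f u) ≤ r}) :
    ∃ t : Finset EngelGroup, t.card * m ≤ V ∧ A ⊆ ⋃ p : t, closedBall d p (2 * r) := by
  classical
  set s : Set ℕ := {n | ∃ t : Finset EngelGroup, (t : Set EngelGroup) ⊆ A ∧
    ((t : Set EngelGroup).Pairwise fun p q => 2 * r < d p q) ∧ t.card = n}
  have hbound : ∀ t : Finset EngelGroup, (t : Set EngelGroup) ⊆ A →
      ((t : Set EngelGroup).Pairwise fun p q => 2 * r < d p q) → t.card * m ≤ V := by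
    intro t htA ht
    have h := (card_mul_le_measure hd μ hmeas (fun p hp => hm p (htA hp)) ht).trans hW
    rw [← ENNReal.ofReal_natCast, ← ENNReal.ofReal_mul (by positivity)] at h
    exact (ENNReal.ofReal_le_ofReal_iff hV).1 h
  have hbdd : BddAbove s := by
    refine ⟨⌈V / m⌉₊, ?_⟩
    rintro n ⟨t, htA, ht, rfl⟩
    have := (le_div_iff₀ hm0).2 (hbound t htA ht)
    exact_mod_cast this.trans (Nat.le_ceil _)
  have hne : s.Nonempty := ⟨0, ∅, by simp, by simp, rfl⟩
  -- The measure bound limits the cardinality of separated subsets, so a largest one exists; an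
  -- uncovered point could be added to it.
  obtain ⟨t, htA, ht, htn⟩ := Nat.sSup_mem hne hbdd
  refine ⟨t, hbound t htA ht, fun x hx => ?_⟩
  by_contra hcon
  have hfar : ∀ p ∈ t, 2 * r < d p x := fun p hp => by
    by_contra hle
    exact hcon (mem_iUnion.2 ⟨⟨p, hp⟩, not_lt.1 hle⟩)
  have hxt : x ∉ t := fun hxt => by
    have := hfar x hxt
    rw [hd.self_eq_zero] at this
    linarith
  have hmem : t.card + 1 ∈ s := by
    refine ⟨insert x t, ?_, ?_, Finset.card_insert_of_notMem hxt⟩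
    · rw [Finset.coe_insert]
      exact insert_subset hx htA
    · rw [Finset.coe_insert]
      refine ht.insert fun p hp _ => ⟨?_, hfar p hp⟩
      rw [hd.symm]
      exact hfar p hp
  have := le_csSup hbdd hmem
  omega

/-- At scale `r` at most `μ W / m r` balls of radius `2 K r` are needed, so the sum of the `N`-th
powers of the radii is at most a constant times `r ^ N / m r`. -/
theorem hasSmallCovers_of_measure (hd : IsHomogeneousDist d) {X : Type*} [MeasurableSpace X]
    (μ : Measure X) {f : X → EngelGroup} {W : Set X} {A : Set EngelGroup} {N : ℕ} {K : ℝ}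
    (hK : 0 < K) (hW : μ W ≠ ∞) (hmeas : ∀ p r, MeasurableSet {u ∈ W | d p (f u) ≤ r})
    {m : ℝ → ℝ} (hm0 : ∀ r, 0 < r → 0 < m r)
    (hm : ∀ᶠ r in 𝓝[>] (0 : ℝ), ∀ p ∈ A, ENNReal.ofReal (m r) ≤ μ {u ∈ W | d p (f u) ≤ K * r})
    (hlim : Tendsto (fun r => r ^ N / m r) (𝓝[>] 0) (𝓝 0)) : HasSmallCovers d N A := by
  intro ε hε
  set V := (μ W).toReal
  have hlim' : Tendsto (fun r => ENNReal.ofReal (V * (2 * K) ^ N * (r ^ N / m r))) (𝓝[>] 0)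
      (𝓝 0) := by
    have := ENNReal.tendsto_ofReal (hlim.const_mul (V * (2 * K) ^ N))
    simpa using this
  obtain ⟨r, hr, hr0, hrε⟩ := (hm.and ((eventually_mem_nhdsWithin (a := (0 : ℝ)) (s := Ioi 0)).and
    (hlim'.eventually (gt_mem_nhds (pos_iff_ne_zero.2 hε))))).exists
  have hr0 : 0 < r := hr0
  obtain ⟨t, ht, hcov⟩ := exists_finset_cover hd μ (mul_pos hK hr0) (hm0 r hr0)
    ENNReal.toReal_nonneg (ENNReal.ofReal_toReal hW).ge (fun p => hmeas p _) hr
  refine ⟨Fin t.card, inferInstance, fun i => t.equivFin.symm i, fun _ => 2 * (K * r),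
    fun _ => by positivity, fun x hx => ?_, ?_⟩
  · obtain ⟨p, hp⟩ := mem_iUnion.1 (hcov hx)
    exact mem_iUnion.2 ⟨t.equivFin p, by simpa using hp⟩
  · refine le_trans ?_ hrε.le
    rw [tsum_fintype, Finset.sum_const, Finset.card_fin, nsmul_eq_mul,
      ← ENNReal.ofReal_pow (by positivity), ← ENNReal.ofReal_natCast,
      ← ENNReal.ofReal_mul (by positivity)]
    refine ENNReal.ofReal_le_ofReal ?_
    have h1 : (t.card : ℝ) ≤ V / m r := (le_div_iff₀ (hm0 r hr0)).2 ht
    calc (t.card : ℝ) * (2 * (K * r)) ^ N ≤ V / m r * (2 * (K * r)) ^ N := by gcongr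
      _ = V * (2 * K) ^ N * (r ^ N / m r) := by rw [← mul_assoc 2 K r, mul_pow (2 * K) r]; ring

/-! ### Area of a slab in a disc -/

/-- In a plane, the part of a disc where a bounded linear form is small has large area. -/
theorem volume_slab_ge (ℓ : EuclideanSpace ℝ (Fin 2) →ₗ[ℝ] ℝ) {K a b : ℝ} (hK : 0 ≤ K)
    (hℓ : ∀ h, |ℓ h| ≤ K * ‖h‖) (ha : 0 < a) (hb : 0 < b) :
    ENNReal.ofReal (a ^ 2 / (4 * (K * a / b + 2))) ≤
      volume {h : EuclideanSpace ℝ (Fin 2) | ‖h‖ ≤ a ∧ |ℓ h| ≤ b} := by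
  classical
  set B := {h : EuclideanSpace ℝ (Fin 2) | ‖h‖ ≤ a ∧ |ℓ h| ≤ b}
  -- Pigeonhole: the disc of half radius is cut into strips where `ℓ` varies by less than `b`.
  -- Translating a strip by minus one of its points puts it inside `B`, and there are at most `K * a
  -- / b + 2` strips.
  set n : ℤ → Set (EuclideanSpace ℝ (Fin 2)) := fun k =>
    {h | h ∈ Metric.closedBall 0 (a / 2) ∧ ⌊ℓ h / b⌋ = k}
  set c : ℝ := K * (a / 2) / b
  have hc : 0 ≤ c := by positivity
  set I : Finset ℤ := Finset.Icc ⌊-c⌋ ⌊c⌋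
  have hcover : Metric.closedBall (0 : EuclideanSpace ℝ (Fin 2)) (a / 2) ⊆ ⋃ k ∈ I, n k := by
    intro h hh
    have hh' : ‖h‖ ≤ a / 2 := by simpa using hh
    have h1 : |ℓ h| ≤ K * (a / 2) := (hℓ h).trans (by gcongr)
    have h2 := abs_le.1 h1
    refine mem_iUnion₂.2 ⟨⌊ℓ h / b⌋, Finset.mem_Icc.2 ⟨Int.floor_mono ?_, Int.floor_mono ?_⟩,
      hh, rfl⟩
    · rw [← neg_div]
      exact div_le_div_of_nonneg_right h2.1 hb.le
    · exact div_le_div_of_nonneg_right h2.2 hb.le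
  have hn : ∀ k, volume (n k) ≤ volume B := by
    intro k
    rcases (n k).eq_empty_or_nonempty with h | ⟨h₀, hh₀, hk₀⟩
    · simp [h]
    · have : n k ⊆ (fun h => -h₀ + h) ⁻¹' B := by
        rintro h ⟨hh, hk⟩
        have e1 : ‖h‖ ≤ a / 2 := by simpa using hh
        have e2 : ‖h₀‖ ≤ a / 2 := by simpa using hh₀
        refine ⟨?_, ?_⟩
        · calc ‖-h₀ + h‖ ≤ ‖-h₀‖ + ‖h‖ := norm_add_le _ _
            _ ≤ a := by rw [norm_neg]; linarith
        · have e3 := Int.abs_sub_lt_one_of_floor_eq_floor (hk.trans hk₀.symm)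
          rw [← sub_div, abs_div, abs_of_pos hb, div_lt_one hb] at e3
          rw [map_add, map_neg, neg_add_eq_sub]
          exact e3.le
      exact (measure_mono this).trans (measure_preimage_add _ _ _).le
  have hcard : (I.card : ℝ) ≤ K * a / b + 2 := by
    have h1 : ⌊-c⌋ ≤ ⌊c⌋ + 1 := (Int.floor_mono (by linarith : -c ≤ c)).trans (by omega)
    have h2 : ((I.card : ℤ) : ℝ) = ((⌊c⌋ + 1 - ⌊-c⌋ : ℤ) : ℝ) := by
      rw [Int.card_Icc_of_le _ _ h1]
    have h3 := Int.floor_le c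
    have h4 := Int.lt_floor_add_one (-c)
    have h5 : K * a / b = 2 * c := by simp only [c]; ring
    push_cast at h2
    linarith
  have hvol : ENNReal.ofReal (a ^ 2 / 4) ≤
      volume (Metric.closedBall (0 : EuclideanSpace ℝ (Fin 2)) (a / 2)) := by
    rw [EuclideanSpace.volume_closedBall_fin_two, ← ENNReal.ofReal_pow (by positivity),
      ← ENNReal.ofReal_mul (by positivity)]
    refine ENNReal.ofReal_le_ofReal ?_
    nlinarith [sq_nonneg a, Real.pi_gt_three]
  have hpos : 0 < K * a / b + 2 := by positivity
  have key : ENNReal.ofReal (a ^ 2 / 4) ≤ ENNReal.ofReal (K * a / b + 2) * volume B := by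
    calc ENNReal.ofReal (a ^ 2 / 4)
        ≤ volume (Metric.closedBall (0 : EuclideanSpace ℝ (Fin 2)) (a / 2)) := hvol
      _ ≤ volume (⋃ k ∈ I, n k) := measure_mono hcover
      _ ≤ ∑ k ∈ I, volume (n k) := measure_biUnion_finset_le _ _
      _ ≤ ∑ k ∈ I, volume B := Finset.sum_le_sum fun k _ => hn k
      _ = I.card * volume B := by simp
      _ ≤ ENNReal.ofReal (K * a / b + 2) * volume B := by
        gcongr
        rw [← ENNReal.ofReal_natCast]
        exact ENNReal.ofReal_le_ofReal hcard
  have e : a ^ 2 / (4 * (K * a / b + 2)) = a ^ 2 / 4 / (K * a / b + 2) := by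
    field_simp
  rw [e, ENNReal.ofReal_div_of_pos hpos]
  exact ENNReal.div_le_of_le_mul' key

/-! ### The left invariant frame and the group law in coordinates -/

instance : ProperSpace EngelGroup := inferInstanceAs (ProperSpace (Fin 4 → ℝ))

instance : SecondCountableTopology EngelGroup :=
  inferInstanceAs (SecondCountableTopology (Fin 4 → ℝ))

theorem abs_apply_le_norm (x : EngelGroup) (i : Fin 4) : |x i| ≤ ‖x‖ :=
  norm_le_pi_norm (ι := Fin 4) (G := fun _ => ℝ) x i

theorem norm_le_of_abs_apply_le {x : EngelGroup} {M : ℝ} (hM : 0 ≤ M) (h : ∀ i, |x i| ≤ M) :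
    ‖x‖ ≤ M :=
  (pi_norm_le_iff_of_nonneg (ι := Fin 4) (G := fun _ => ℝ) (x := x) hM).2 h

/-- The coordinates of a tangent vector `v` at `p` with respect to the left invariant frame. -/
def maurerCartan (p : EngelGroup) : EngelGroup →ₗ[ℝ] EngelGroup where
  toFun v := ![v 0, v 1, v 2 - (p 0 * v 1 - p 1 * v 0) / 2,
    v 3 - (p 0 * v 2 - p 2 * v 0) / 2 + p 0 * (p 0 * v 1 - p 1 * v 0) / 6]
  map_add' v w := by
    refine EngelGroup.ext rfl rfl ?_ ?_
    · change v 2 + w 2 - (p 0 * (v 1 + w 1) - p 1 * (v 0 + w 0)) / 2 =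
        (v 2 - (p 0 * v 1 - p 1 * v 0) / 2) + (w 2 - (p 0 * w 1 - p 1 * w 0) / 2)
      ring
    · change v 3 + w 3 - (p 0 * (v 2 + w 2) - p 2 * (v 0 + w 0)) / 2 +
          p 0 * (p 0 * (v 1 + w 1) - p 1 * (v 0 + w 0)) / 6 =
        (v 3 - (p 0 * v 2 - p 2 * v 0) / 2 + p 0 * (p 0 * v 1 - p 1 * v 0) / 6) +
          (w 3 - (p 0 * w 2 - p 2 * w 0) / 2 + p 0 * (p 0 * w 1 - p 1 * w 0) / 6)
      ring
  map_smul' c v := by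
    refine EngelGroup.ext rfl rfl ?_ ?_
    · change c * v 2 - (p 0 * (c * v 1) - p 1 * (c * v 0)) / 2 =
        c * (v 2 - (p 0 * v 1 - p 1 * v 0) / 2)
      ring
    · change c * v 3 - (p 0 * (c * v 2) - p 2 * (c * v 0)) / 2 +
          p 0 * (p 0 * (c * v 1) - p 1 * (c * v 0)) / 6 =
        c * (v 3 - (p 0 * v 2 - p 2 * v 0) / 2 + p 0 * (p 0 * v 1 - p 1 * v 0) / 6)
      ring

@[simp] theorem maurerCartan_zero (p v : EngelGroup) : maurerCartan p v 0 = v 0 := rfl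

@[simp] theorem maurerCartan_one (p v : EngelGroup) : maurerCartan p v 1 = v 1 := rfl

theorem maurerCartan_two (p v : EngelGroup) :
    maurerCartan p v 2 = v 2 - (p 0 * v 1 - p 1 * v 0) / 2 := rfl

theorem maurerCartan_three (p v : EngelGroup) : maurerCartan p v 3 =
    v 3 - (p 0 * v 2 - p 2 * v 0) / 2 + p 0 * (p 0 * v 1 - p 1 * v 0) / 6 := rfl

theorem abs_maurerCartan_le {p : EngelGroup} {M : ℝ} (hp : ‖p‖ ≤ M) (v : EngelGroup)
    (i : Fin 4) : |maurerCartan p v i| ≤ (1 + M) ^ 2 * ‖v‖ := by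
  have hM : 0 ≤ M := (norm_nonneg p).trans hp
  have hv := fun j => abs_apply_le_norm v j
  have hpv : ∀ j k, |p j * v k| ≤ M * ‖v‖ := fun j k => by
    rw [abs_mul]
    exact mul_le_mul ((abs_apply_le_norm p j).trans hp) (hv k) (abs_nonneg _) hM
  have h1 : |p 0 * v 1 - p 1 * v 0| ≤ 2 * (M * ‖v‖) := (abs_sub _ _).trans
    (by linarith [hpv 0 1, hpv 1 0])
  have h2 : |p 0 * v 2 - p 2 * v 0| ≤ 2 * (M * ‖v‖) := (abs_sub _ _).trans
    (by linarith [hpv 0 2, hpv 2 0])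
  have h3 : |p 0 * (p 0 * v 1 - p 1 * v 0)| ≤ M * (2 * (M * ‖v‖)) := by
    rw [abs_mul]
    exact mul_le_mul ((abs_apply_le_norm p 0).trans hp) h1 (abs_nonneg _) hM
  have hn := norm_nonneg v
  have hMn : 0 ≤ M * ‖v‖ := by positivity
  have hMMn : 0 ≤ M * (M * ‖v‖) := by positivity
  have e : (1 + M) ^ 2 * ‖v‖ = ‖v‖ + 2 * (M * ‖v‖) + M * (M * ‖v‖) := by ring
  rw [e]
  fin_cases i
  · exact (hv 0).trans (by linarith)
  · exact (hv 1).trans (by linarith)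
  · change |v 2 - (p 0 * v 1 - p 1 * v 0) / 2| ≤ _
    have := abs_le.1 (hv 2)
    have := abs_le.1 h1
    rw [abs_le]
    constructor <;> linarith
  · change |v 3 - (p 0 * v 2 - p 2 * v 0) / 2 + p 0 * (p 0 * v 1 - p 1 * v 0) / 6| ≤ _
    have := abs_le.1 (hv 3)
    have := abs_le.1 h2
    have := abs_le.1 h3
    rw [abs_le]
    constructor <;> linarith

theorem mul_apply_zero (x y : EngelGroup) : (x * y) 0 = x 0 + y 0 := by
  simp [mul_def]

theorem mul_apply_one (x y : EngelGroup) : (x * y) 1 = x 1 + y 1 := by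
  simp [mul_def]

theorem mul_apply_two (x y : EngelGroup) :
    (x * y) 2 = x 2 + y 2 + (x 0 * y 1 - x 1 * y 0) / 2 := by
  simp [mul_def]; ring

theorem mul_apply_three (x y : EngelGroup) :
    (x * y) 3 = x 3 + y 3 + (x 0 * y 2 - x 2 * y 0) / 2 +
      (x 0 - y 0) * (x 0 * y 1 - x 1 * y 0) / 12 := by
  simp [mul_def]; ring

theorem inv_mul_apply_zero (p q : EngelGroup) : (p⁻¹ * q) 0 = (q - p) 0 := by
  rw [mul_apply_zero]; simp [inv_def, sub_eq_add_neg, add_comm]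

theorem inv_mul_apply_one (p q : EngelGroup) : (p⁻¹ * q) 1 = (q - p) 1 := by
  rw [mul_apply_one]; simp [inv_def, sub_eq_add_neg, add_comm]

theorem inv_mul_apply_two (p q : EngelGroup) : (p⁻¹ * q) 2 = maurerCartan p (q - p) 2 := by
  rw [mul_apply_two, maurerCartan_two]; simp [inv_def, sub_eq_add_neg]; ring

/-- Unlike the first three coordinates, the last one is not affine in `q`: the triple brackets leave
a correction quadratic in `q - p`. -/
theorem inv_mul_apply_three (p q : EngelGroup) : (p⁻¹ * q) 3 = maurerCartan p (q - p) 3 +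
    (q - p) 0 * (p 0 * (q - p) 1 - p 1 * (q - p) 0) / 12 := by
  rw [mul_apply_three, maurerCartan_three]; simp [inv_def, sub_eq_add_neg]; ring

theorem leftField_maurerCartan (p v : EngelGroup) : leftField (maurerCartan p v) p = v := by
  have hc : ∀ i : Fin 4, HasFDerivAt (fun q : EngelGroup => q i)
      (ContinuousLinearMap.proj (R := ℝ) (φ := fun _ : Fin 4 => ℝ) i) 1 := fun i =>
    (ContinuousLinearMap.proj (R := ℝ) (φ := fun _ : Fin 4 => ℝ) i).hasFDerivAt
  have hdiff : DifferentiableAt ℝ (fun q : EngelGroup => p * q) 1 := by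
    refine differentiableAt_pi.2 fun i => ?_
    have h := fun j => (hc j).differentiableAt
    have h0 := h 0
    have h1 := h 1
    have h2 := h 2
    have h3 := h 3
    fin_cases i
    · simp only [Fin.zero_eta, mul_apply_zero]; fun_prop
    · simp only [Fin.mk_one, mul_apply_one]; fun_prop
    · simp only [Fin.reduceFinMk, mul_apply_two]; fun_prop
    · simp only [Fin.reduceFinMk, mul_apply_three]; fun_prop
  set Z := maurerCartan p v
  have hline : HasDerivAt (fun t : ℝ => p * (t • Z)) (leftField Z p) 0 := by
    have h1 : HasDerivAt (fun t : ℝ => t • Z) Z 0 := by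
      simpa using (hasDerivAt_id (0 : ℝ)).smul_const Z
    have h2 : HasFDerivAt (fun q : EngelGroup => p * q)
        (fderiv ℝ (fun q : EngelGroup => p * q) 1) ((0 : ℝ) • Z) := by
      rw [zero_smul]; exact hdiff.hasFDerivAt
    exact h2.comp_hasDerivAt 0 h1
  have hco := fun i => (hasDerivAt_pi.1 hline i).deriv
  -- Along `t • Z` each coordinate of the product has degree at most two in `t`, so its derivative
  -- at `0` is the linear coefficient.
  have hexp : ∀ a b c : ℝ, deriv (fun t : ℝ => a + t * b + t ^ 2 * c) 0 = b := fun a b c => by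
    have : HasDerivAt (fun t : ℝ => a + t * b + t ^ 2 * c) b 0 := by
      simpa using! (((hasDerivAt_id (0 : ℝ)).mul_const b).const_add a).add
        (((hasDerivAt_id (0 : ℝ)).pow 2).mul_const c)
    exact this.deriv
  have key : ∀ i, ∀ b c : ℝ, (∀ t : ℝ, (p * (t • Z)) i = p i + t * b + t ^ 2 * c) →
      leftField Z p i = b := fun i b c h => by
    rw [← hco i, ← hexp (p i) b c]
    exact congrArg (fun f => deriv f 0) (funext h)
  have hZ2 : Z 2 = v 2 - (p 0 * v 1 - p 1 * v 0) / 2 := rfl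
  have hZ3 : Z 3 = v 3 - (p 0 * v 2 - p 2 * v 0) / 2 + p 0 * (p 0 * v 1 - p 1 * v 0) / 6 := rfl
  ext
  · exact key 0 (v 0) 0 fun t => by rw [mul_apply_zero]; simp [Z]
  · exact key 1 (v 1) 0 fun t => by rw [mul_apply_one]; simp [Z]
  · refine key 2 (v 2) 0 fun t => ?_
    rw [mul_apply_two, smul_apply, smul_apply, smul_apply, hZ2]
    simp only [Z, maurerCartan_zero, maurerCartan_one]; ring
  · refine key 3 (v 3) (-(v 0 * (p 0 * v 1 - p 1 * v 0) / 12)) fun t => ?_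
    rw [mul_apply_three, smul_apply, smul_apply, smul_apply, smul_apply, hZ2, hZ3]
    simp only [Z, maurerCartan_zero, maurerCartan_one]; ring

theorem IsHomogeneousDist.eq_one_inv_mul (hd : IsHomogeneousDist d) (p q : EngelGroup) :
    d p q = d 1 (p⁻¹ * q) := by
  rw [← hd.left_invariant p⁻¹ p q, inv_mul_cancel]

/-- A homogeneous distance is controlled by any other homogeneous norm. -/
theorem IsHomogeneousDist.exists_le_of_abs_le (hd : IsHomogeneousDist d) (M : ℝ) :
    ∃ K : ℝ, 0 < K ∧ ∀ r : ℝ, 0 < r → ∀ p q : EngelGroup,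
      (∀ i, |(p⁻¹ * q) i| ≤ M * r ^ weight i) → d p q ≤ K * r := by
  have hcont : Continuous fun z : EngelGroup => d 1 z :=
    hd.continuous.comp (Continuous.prodMk_right 1)
  obtain ⟨K, hK⟩ := (isCompact_closedBall (0 : EngelGroup) M).exists_bound_of_continuousOn
    hcont.continuousOn
  refine ⟨max K 1, lt_max_of_lt_right one_pos, fun r hr p q hz => ?_⟩
  rw [hd.eq_one_inv_mul]
  set z := p⁻¹ * q
  have hM : 0 ≤ M := nonneg_of_mul_nonneg_left
    ((abs_nonneg _).trans (hz 0)) (pow_pos hr (weight 0))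
  -- Rescaling to unit size puts `y` in a fixed compact ball, where `d 1` is bounded by continuity.
  set y : EngelGroup := dilation r⁻¹ z
  have hy : ‖y‖ ≤ M := by
    refine norm_le_of_abs_apply_le hM fun i => ?_
    change |r⁻¹ ^ weight i * z i| ≤ M
    rw [abs_mul, abs_of_pos (by positivity), inv_pow, inv_mul_le_iff₀ (by positivity), mul_comm]
    exact hz i
  have hzy : z = dilation r y := by
    funext i
    change z i = r ^ weight i * (r⁻¹ ^ weight i * z i)
    rw [← mul_assoc, ← mul_pow, mul_inv_cancel₀ hr.ne', one_pow, one_mul]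
  have h1 : (1 : EngelGroup) = dilation r 1 := by
    funext i
    change (0 : ℝ) = r ^ weight i * 0
    simp
  rw [hzy, h1, hd.homogeneous r hr, mul_comm]
  refine mul_le_mul_of_nonneg_right (((le_abs_self _).trans (hK y ?_)).trans (le_max_left _ _)) hr.le
  simpa using hy

/-! ### Pointwise degree and the tangent plane -/

theorem vectorDegree_le {k : ℕ} (ξ : ⋀[ℝ]^k EngelGroup) : vectorDegree ξ ≤ ∑ i, weight i :=
  Finset.sup_le fun _ _ => Finset.sum_le_univ_sum_of_nonneg fun _ => Nat.zero_le _

/-- The minor is the coefficient of `X_i ∧ X_j` in `Z₀ ∧ Z₁`; were it nonzero, it would count in the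
degree. -/
theorem minor_eq_zero_of_vectorDegree_lt (Z : Fin 2 → EngelGroup) {i j : Fin 4} (hij : i < j)
    (h : vectorDegree (exteriorPower.ιMulti ℝ 2 Z) < weight i + weight j) :
    Z 0 i * Z 1 j - Z 0 j * Z 1 i = 0 := by
  by_contra hne
  have hmono : StrictMono ![i, j] := by
    intro a b hab
    fin_cases a <;> fin_cases b <;> simp_all
  set f : Fin 2 ↪o Fin 4 := OrderEmbedding.ofStrictMono _ hmono
  set s := Set.powersetCard.ofFinEmbEquiv f
  have hs : s ∈ ((basis.exteriorPower 2).repr (exteriorPower.ιMulti ℝ 2 Z)).support := by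
    rw [Finsupp.mem_support_iff, exteriorPower.basis_repr_apply,
      exteriorPower.ιMultiDual_apply_ιMulti, Matrix.det_fin_two]
    simpa [s, f, basis] using! hne
  have hle := Finset.le_sup (f := fun I : Set.powersetCard (Fin 4) 2 =>
    ∑ i ∈ (I : Finset (Fin 4)), weight i) hs
  have hsum : ∑ i ∈ (s : Finset (Fin 4)), weight i = weight i + weight j := by
    have : (s : Finset (Fin 4)) = Finset.univ.map f.toEmbedding := rfl
    rw [this, Finset.sum_map, Fin.sum_univ_two]
    simp [f]
  rw [hsum] at hle
  exact absurd h (not_lt.2 hle)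

theorem pointDegree_le_degree {S : Set EngelGroup} {p : EngelGroup} (hp : p ∈ S) :
    pointDegree S p ≤ degree S := by
  refine le_csSup ⟨∑ i, weight i, ?_⟩ (mem_image_of_mem _ hp)
  rintro _ ⟨q, -, rfl⟩
  refine csSup_le' ?_
  rintro n ⟨Z, -, -, rfl⟩
  exact vectorDegree_le _

/-- Since `pointDegree` is a supremum over bases, this inequality for one basis suffices and
independence of the basis is never needed. The total weight bounds the set, without which `sSup` in
`ℕ` would default to `0`. -/
theorem vectorDegree_le_pointDegree {S : Set EngelGroup} {p : EngelGroup}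
    {v : Fin 2 → EngelGroup} (hv : ∀ k, v k ∈ tangentSpace S p) (hli : LinearIndependent ℝ v) :
    vectorDegree (exteriorPower.ιMulti ℝ 2 fun k => maurerCartan p (v k)) ≤ pointDegree S p := by
  refine le_csSup ⟨∑ i, weight i, ?_⟩ ⟨fun k => maurerCartan p (v k), ?_, ?_, rfl⟩
  · rintro n ⟨Z, -, -, rfl⟩
    exact vectorDegree_le _
  · simpa only [leftField_maurerCartan] using hv
  · simpa only [leftField_maurerCartan] using hli

theorem linearIndependent_maurerCartan (p : EngelGroup) {v : Fin 2 → EngelGroup}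
    (hli : LinearIndependent ℝ v) : LinearIndependent ℝ fun k => maurerCartan p (v k) := by
  refine LinearIndependent.of_comp (fderiv ℝ (fun q : EngelGroup => p * q) 1).toLinearMap ?_
  convert hli using 1
  funext k
  exact leftField_maurerCartan p (v k)

/-- The minors through column `j` are the entries of `Z 1 j • Z 0 - Z 0 j • Z 1`; if they vanish,
independence kills both coefficients. -/
theorem apply_eq_zero_of_minors {Z : Fin 2 → EngelGroup} (hZ : LinearIndependent ℝ Z) {j : Fin 4}
    (h : ∀ i, i ≠ j → Z 0 i * Z 1 j - Z 0 j * Z 1 i = 0) (k : Fin 2) : Z k j = 0 := by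
  have hZ' : LinearIndependent ℝ ![Z 0, Z 1] := by
    convert hZ using 1
    funext k
    fin_cases k <;> rfl
  have hw : Z 1 j • Z 0 + (-Z 0 j) • Z 1 = 0 := by
    funext i
    by_cases hij : i = j
    · subst hij
      simp; ring
    · have := h i hij
      simp only [add_apply, smul_apply, zero_apply]
      linarith
  obtain ⟨h1, h0⟩ := LinearIndependent.pair_iff.1 hZ' _ _ hw
  fin_cases k
  · simpa using h0
  · exact h1

theorem minor_eq_zero {S : Set EngelGroup} {p : EngelGroup} {v : Fin 2 → EngelGroup}
    (hv : ∀ k, v k ∈ tangentSpace S p) (hli : LinearIndependent ℝ v) {i j : Fin 4} (hij : i ≠ j)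
    (h : pointDegree S p < weight i + weight j) :
    maurerCartan p (v 0) i * maurerCartan p (v 1) j -
      maurerCartan p (v 0) j * maurerCartan p (v 1) i = 0 := by
  have hlt := (vectorDegree_le_pointDegree hv hli).trans_lt h
  rcases hij.lt_or_gt with hij | hij
  · exact minor_eq_zero_of_vectorDegree_lt _ hij hlt
  · rw [add_comm] at hlt
    linarith [minor_eq_zero_of_vectorDegree_lt _ hij hlt]

/-- At a point of degree at most three the tangent plane is spanned by `X₁, X₂, X₃`. -/
theorem maurerCartan_three_eq_zero {S : Set EngelGroup} {p : EngelGroup} {v : Fin 2 → EngelGroup}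
    (hv : ∀ k, v k ∈ tangentSpace S p) (hli : LinearIndependent ℝ v) (h : pointDegree S p ≤ 3)
    (k : Fin 2) : maurerCartan p (v k) 3 = 0 := by
  refine apply_eq_zero_of_minors (linearIndependent_maurerCartan p hli)
    (fun i hi => minor_eq_zero hv hli hi (h.trans_lt ?_)) k
  fin_cases i <;> simp_all [weight]

/-- At a point of degree at most two the tangent plane is horizontal. -/
theorem maurerCartan_two_eq_zero {S : Set EngelGroup} {p : EngelGroup} {v : Fin 2 → EngelGroup}
    (hv : ∀ k, v k ∈ tangentSpace S p) (hli : LinearIndependent ℝ v) (h : pointDegree S p ≤ 2)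
    (k : Fin 2) : maurerCartan p (v k) 2 = 0 := by
  refine apply_eq_zero_of_minors (linearIndependent_maurerCartan p hli)
    (fun i hi => minor_eq_zero hv hli hi (h.trans_lt ?_)) k
  fin_cases i <;> simp_all [weight]

theorem two_le_pointDegree {S : Set EngelGroup} {p : EngelGroup} {v : Fin 2 → EngelGroup}
    (hv : ∀ k, v k ∈ tangentSpace S p) (hli : LinearIndependent ℝ v) : 2 ≤ pointDegree S p := by
  by_contra! h
  have hZ := linearIndependent_maurerCartan p hli
  refine hZ.ne_zero 0 (funext fun j => ?_)
  refine apply_eq_zero_of_minors hZ (fun i hi => minor_eq_zero hv hli hi (h.trans_le ?_)) 0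
  fin_cases i <;> fin_cases j <;> simp [weight]

/-! ### Hölder bounds and the decay of each coordinate -/

/-- Uniform `C^{1,α}` bounds for `φ` on the disc of center `u₀` and radius `2 R`. -/
structure HasHolderBounds (α : ℝ≥0) (φ : EuclideanSpace ℝ (Fin 2) → EngelGroup)
    (u₀ : EuclideanSpace ℝ (Fin 2)) (R M : ℝ) : Prop where
  radius_pos : 0 < R
  radius_le : R ≤ 1
  nonneg : 0 ≤ M
  differentiableAt : ∀ v ∈ Metric.closedBall u₀ (2 * R), DifferentiableAt ℝ φ v
  norm_le : ∀ v ∈ Metric.closedBall u₀ (2 * R), ‖φ v‖ ≤ M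
  norm_fderiv_le : ∀ v ∈ Metric.closedBall u₀ (2 * R), ‖fderiv ℝ φ v‖ ≤ M
  norm_fderiv_sub_le : ∀ v ∈ Metric.closedBall u₀ (2 * R), ∀ w ∈ Metric.closedBall u₀ (2 * R),
    ‖fderiv ℝ φ v - fderiv ℝ φ w‖ ≤ M * ‖v - w‖ ^ (α : ℝ)

theorem IsLocalParam.exists_hasHolderBounds {α : ℝ≥0} {S : Set EngelGroup}
    {U : Set (EuclideanSpace ℝ (Fin 2))} {φ : EuclideanSpace ℝ (Fin 2) → EngelGroup}
    (hφ : IsLocalParam α S U φ) {u₀ : EuclideanSpace ℝ (Fin 2)} (hu₀ : u₀ ∈ U) :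
    ∃ R M, Metric.closedBall u₀ (2 * R) ⊆ U ∧ HasHolderBounds α φ u₀ R M := by
  obtain ⟨W, hW, C, hC⟩ := hφ.locally_holder u₀ hu₀
  obtain ⟨ρ, hρ, hball⟩ := Metric.nhds_basis_closedBall.mem_iff.1
    (inter_mem hW (hφ.isOpen.mem_nhds hu₀))
  have hcont := hφ.contDiffOn.continuousOn
  have hcont' := hφ.contDiffOn.continuousOn_fderiv_of_isOpen hφ.isOpen le_rfl
  set R := min 1 (ρ / 2)
  have hsub : Metric.closedBall u₀ (2 * R) ⊆ W ∩ U :=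
    (Metric.closedBall_subset_closedBall (by linarith [min_le_right 1 (ρ / 2)])).trans hball
  have hU : Metric.closedBall u₀ (2 * R) ⊆ U := fun v hv => (hsub hv).2
  obtain ⟨M₁, hM₁⟩ := (isCompact_closedBall u₀ (2 * R)).exists_bound_of_continuousOn
    (hcont.mono hU)
  obtain ⟨M₂, hM₂⟩ := (isCompact_closedBall u₀ (2 * R)).exists_bound_of_continuousOn
    (hcont'.mono hU)
  refine ⟨R, max C (max M₁ M₂), hU, lt_min one_pos (by positivity), min_le_left _ _,
    le_max_of_le_left C.2, fun v hv => ?_, fun v hv => ?_, fun v hv => ?_, fun v hv w hw => ?_⟩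
  · exact (hφ.contDiffOn.differentiableOn one_ne_zero).differentiableAt
      (hφ.isOpen.mem_nhds (hU hv))
  · exact (hM₁ v hv).trans ((le_max_left _ _).trans (le_max_right _ _))
  · exact (hM₂ v hv).trans ((le_max_right _ _).trans (le_max_right _ _))
  · rw [← dist_eq_norm, ← dist_eq_norm]
    exact (hC.dist_le (hsub hv).1 (hsub hw).1).trans
      (mul_le_mul_of_nonneg_right (le_max_left _ _) (by positivity))

namespace HasHolderBounds

variable {α : ℝ≥0} {φ : EuclideanSpace ℝ (Fin 2) → EngelGroup}
  {u₀ u h : EuclideanSpace ℝ (Fin 2)} {R M : ℝ}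

theorem mem_closedBall_add (_hB : HasHolderBounds α φ u₀ R M) (hu : u ∈ Metric.closedBall u₀ R)
    (hh : ‖h‖ ≤ R) : u + h ∈ Metric.closedBall u₀ (2 * R) := by
  rw [Metric.mem_closedBall, dist_eq_norm] at hu ⊢
  calc ‖u + h - u₀‖ = ‖(u - u₀) + h‖ := by congr 1; abel
    _ ≤ ‖u - u₀‖ + ‖h‖ := norm_add_le _ _
    _ ≤ 2 * R := by linarith

theorem mem_closedBall (hB : HasHolderBounds α φ u₀ R M) (hu : u ∈ Metric.closedBall u₀ R) :
    u ∈ Metric.closedBall u₀ (2 * R) :=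
  Metric.closedBall_subset_closedBall (by linarith [hB.radius_pos]) hu

theorem norm_sub_le (hB : HasHolderBounds α φ u₀ R M) (hu : u ∈ Metric.closedBall u₀ R)
    (hh : ‖h‖ ≤ R) : ‖φ (u + h) - φ u‖ ≤ M * ‖h‖ := by
  have := (convex_closedBall u₀ (2 * R)).norm_image_sub_le_of_norm_fderiv_le (𝕜 := ℝ)
    hB.differentiableAt hB.norm_fderiv_le (hB.mem_closedBall hu) (hB.mem_closedBall_add hu hh)
  simpa using this

/-- Mean value inequality for `φ` minus its differential at `u`, on the disc around `u` of radius
`‖h‖`. -/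
theorem norm_sub_sub_le (hB : HasHolderBounds α φ u₀ R M) (hu : u ∈ Metric.closedBall u₀ R)
    (hh : ‖h‖ ≤ R) :
    ‖φ (u + h) - φ u - fderiv ℝ φ u h‖ ≤ M * (‖h‖ ^ (α : ℝ) * ‖h‖) := by
  have hsub : Metric.closedBall u ‖h‖ ⊆ Metric.closedBall u₀ (2 * R) := fun v hv => by
    have := hB.mem_closedBall_add (h := v - u) hu
      ((by simpa [dist_eq_norm] using hv : ‖v - u‖ ≤ ‖h‖).trans hh)
    simpa using this
  have := (convex_closedBall u ‖h‖).norm_image_sub_le_of_norm_fderiv_le' (𝕜 := ℝ) (f := φ)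
    (φ := fderiv ℝ φ u) (C := M * ‖h‖ ^ (α : ℝ)) (x := u) (y := u + h)
    (fun v hv => hB.differentiableAt v (hsub hv)) (fun v hv => ?_)
    (Metric.mem_closedBall_self (norm_nonneg _)) (by simp)
  · simpa [mul_assoc] using this
  · refine (hB.norm_fderiv_sub_le v (hsub hv) u (hB.mem_closedBall hu)).trans ?_
    have hv' : ‖v - u‖ ≤ ‖h‖ := by simpa [dist_eq_norm] using hv
    exact mul_le_mul_of_nonneg_left (Real.rpow_le_rpow (norm_nonneg _) hv' α.2) hB.nonneg

/-- Because `‖h‖ ≤ R ≤ 1`, quadratic terms of the group law are absorbed by the Hölder error. -/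
theorem sq_norm_le (hB : HasHolderBounds α φ u₀ R M) (hα : α ≤ 1) (hh : ‖h‖ ≤ R) :
    ‖h‖ ^ 2 ≤ ‖h‖ ^ (α : ℝ) * ‖h‖ := by
  rw [sq]
  refine mul_le_mul_of_nonneg_right ?_ (norm_nonneg h)
  rcases (norm_nonneg h).eq_or_lt with h0 | h0
  · rw [← h0]; positivity
  · calc ‖h‖ = ‖h‖ ^ (1 : ℝ) := (Real.rpow_one _).symm
      _ ≤ ‖h‖ ^ (α : ℝ) :=
        Real.rpow_le_rpow_of_exponent_ge h0 (hh.trans hB.radius_le) (by exact_mod_cast hα)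

theorem abs_inv_mul_zero_le (hB : HasHolderBounds α φ u₀ R M) (hu : u ∈ Metric.closedBall u₀ R)
    (hh : ‖h‖ ≤ R) : |((φ u)⁻¹ * φ (u + h)) 0| ≤ M * ‖h‖ := by
  rw [inv_mul_apply_zero]
  exact (abs_apply_le_norm _ _).trans (hB.norm_sub_le hu hh)

theorem abs_inv_mul_one_le (hB : HasHolderBounds α φ u₀ R M) (hu : u ∈ Metric.closedBall u₀ R)
    (hh : ‖h‖ ≤ R) : |((φ u)⁻¹ * φ (u + h)) 1| ≤ M * ‖h‖ := by
  rw [inv_mul_apply_one]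
  exact (abs_apply_le_norm _ _).trans (hB.norm_sub_le hu hh)

theorem abs_maurerCartan_sub_le (hB : HasHolderBounds α φ u₀ R M)
    (hu : u ∈ Metric.closedBall u₀ R) (hh : ‖h‖ ≤ R) (i : Fin 4) :
    |maurerCartan (φ u) (φ (u + h) - φ u) i| ≤ |maurerCartan (φ u) (fderiv ℝ φ u h) i| +
      (1 + M) ^ 2 * M * (‖h‖ ^ (α : ℝ) * ‖h‖) := by
  have e : φ (u + h) - φ u = fderiv ℝ φ u h + (φ (u + h) - φ u - fderiv ℝ φ u h) := by abel
  rw [e, map_add, add_apply]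
  refine (abs_add_le _ _).trans (add_le_add le_rfl ?_)
  refine (abs_maurerCartan_le (hB.norm_le u (hB.mem_closedBall hu)) _ i).trans ?_
  rw [mul_assoc]
  exact mul_le_mul_of_nonneg_left (hB.norm_sub_sub_le hu hh) (by positivity)

theorem abs_inv_mul_two_le (hB : HasHolderBounds α φ u₀ R M) (hu : u ∈ Metric.closedBall u₀ R)
    (hh : ‖h‖ ≤ R) : |((φ u)⁻¹ * φ (u + h)) 2| ≤ |maurerCartan (φ u) (fderiv ℝ φ u h) 2| +
      (1 + M) ^ 2 * M * (‖h‖ ^ (α : ℝ) * ‖h‖) := by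
  rw [inv_mul_apply_two]
  exact hB.abs_maurerCartan_sub_le hu hh 2

/-- With no `X₄` component in the direction `h`, only the Hölder remainder and the quadratic
correction of the group law are left. -/
theorem abs_inv_mul_three_le (hB : HasHolderBounds α φ u₀ R M) (hα : α ≤ 1)
    (hu : u ∈ Metric.closedBall u₀ R) (hh : ‖h‖ ≤ R)
    (h3 : maurerCartan (φ u) (fderiv ℝ φ u h) 3 = 0) :
    |((φ u)⁻¹ * φ (u + h)) 3| ≤ (1 + M) ^ 4 * (‖h‖ ^ (α : ℝ) * ‖h‖) := by
  have hM := hB.nonneg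
  have hp := hB.norm_le u (hB.mem_closedBall hu)
  have hs := hB.sq_norm_le hα hh
  have hs0 : 0 ≤ ‖h‖ ^ (α : ℝ) * ‖h‖ := by positivity
  have h1 := hB.abs_maurerCartan_sub_le hu hh 3
  rw [h3, abs_zero, zero_add] at h1
  have hΔ := hB.norm_sub_le hu hh
  rw [inv_mul_apply_three]
  set Δ := φ (u + h) - φ u
  have hMh : 0 ≤ M * ‖h‖ := by positivity
  have hΔi : ∀ i, |Δ i| ≤ M * ‖h‖ := fun i => (abs_apply_le_norm _ _).trans hΔ
  have hpΔ : ∀ i j, |φ u i * Δ j| ≤ M * (M * ‖h‖) := fun i j => by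
    rw [abs_mul]
    exact mul_le_mul ((abs_apply_le_norm _ _).trans hp) (hΔi j) (abs_nonneg _) hM
  have h4 : |φ u 0 * Δ 1 - φ u 1 * Δ 0| ≤ 2 * (M * (M * ‖h‖)) :=
    (abs_sub _ _).trans (by linarith [hpΔ 0 1, hpΔ 1 0])
  have h5 : |Δ 0 * (φ u 0 * Δ 1 - φ u 1 * Δ 0)| ≤ M * ‖h‖ * (2 * (M * (M * ‖h‖))) := by
    rw [abs_mul]
    exact mul_le_mul (hΔi 0) h4 (abs_nonneg _) hMh
  calc |maurerCartan (φ u) Δ 3 + Δ 0 * (φ u 0 * Δ 1 - φ u 1 * Δ 0) / 12|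
      ≤ |maurerCartan (φ u) Δ 3| + |Δ 0 * (φ u 0 * Δ 1 - φ u 1 * Δ 0)| / 12 := by
        refine (abs_add_le _ _).trans (le_of_eq ?_)
        rw [abs_div]; norm_num
    _ ≤ (1 + M) ^ 2 * M * (‖h‖ ^ (α : ℝ) * ‖h‖) + M ^ 3 * ‖h‖ ^ 2 := by
        have : 0 ≤ M ^ 3 * ‖h‖ ^ 2 := by positivity
        have e : M * ‖h‖ * (2 * (M * (M * ‖h‖))) = 2 * (M ^ 3 * ‖h‖ ^ 2) := by ring
        linarith
    _ ≤ (1 + M) ^ 2 * M * (‖h‖ ^ (α : ℝ) * ‖h‖) + M ^ 3 * (‖h‖ ^ (α : ℝ) * ‖h‖) := by gcongr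
    _ = ((1 + M) ^ 2 * M + M ^ 3) * (‖h‖ ^ (α : ℝ) * ‖h‖) := by ring
    _ ≤ (1 + M) ^ 4 * (‖h‖ ^ (α : ℝ) * ‖h‖) := by
        refine mul_le_mul_of_nonneg_right ?_ hs0
        have : 0 ≤ 1 + 3 * M + 4 * M ^ 2 + 2 * M ^ 3 + M ^ 4 := by positivity
        nlinarith

/-- If the surface is tangent to the distribution spanned by `X₁, X₂, X₃`, then the last coordinate
has a better decay at horizontal points. -/
theorem abs_inv_mul_three_le_of_horizontal (hB : HasHolderBounds α φ u₀ R M) (hα : α ≤ 1)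
    (hu : u ∈ Metric.closedBall u₀ R) (hh : ‖h‖ ≤ R)
    (h3 : ∀ v ∈ Metric.closedBall u₀ (2 * R), maurerCartan (φ v) (fderiv ℝ φ v h) 3 = 0)
    (h2 : ∀ k, maurerCartan (φ u) (fderiv ℝ φ u k) 2 = 0) :
    |((φ u)⁻¹ * φ (u + h)) 3| ≤ (1 + M) ^ 4 * (‖h‖ * (‖h‖ ^ (α : ℝ) * ‖h‖)) := by
  have hM := hB.nonneg
  have hp := hB.norm_le u (hB.mem_closedBall hu)
  have hs := hB.sq_norm_le hα hh
  set s := ‖h‖ ^ (α : ℝ) * ‖h‖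
  have hs0 : 0 ≤ s := by positivity
  set p := φ u
  set y : ℝ → EngelGroup := fun t => φ (u + t • h)
  set v : ℝ → EngelGroup := fun t => fderiv ℝ φ (u + t • h) h
  have hth : ∀ t ∈ Icc (0 : ℝ) 1, ‖t • h‖ ≤ ‖h‖ := fun t ht => by
    rw [norm_smul, Real.norm_of_nonneg ht.1]
    exact mul_le_of_le_one_left (norm_nonneg _) ht.2
  have hmem : ∀ t ∈ Icc (0 : ℝ) 1, u + t • h ∈ Metric.closedBall u₀ (2 * R) := fun t ht =>
    hB.mem_closedBall_add hu ((hth t ht).trans hh)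
  have hy : ∀ t ∈ Icc (0 : ℝ) 1, HasDerivAt y (v t) t := fun t ht => by
    have h1 : HasDerivAt (fun t : ℝ => u + t • h) h t := by
      simpa using ((hasDerivAt_id t).smul_const h).const_add u
    exact (hB.differentiableAt _ (hmem t ht)).hasFDerivAt.comp_hasDerivAt t h1
  have hyi : ∀ t ∈ Icc (0 : ℝ) 1, ∀ i, HasDerivAt (fun t => y t i) (v t i) t := fun t ht =>
    hasDerivAt_pi.1 (hy t ht)
  -- Derivative of the last coordinate of `p⁻¹ * y t`; integrating a bound on it over `[0, 1]` gives
  -- the claim.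
  set g' : ℝ → ℝ := fun t => v t 3 - (p 0 * v t 2 - p 2 * v t 0) / 2 +
    (v t 0 * (p 0 * y t 1 - p 1 * y t 0) + (p 0 + y t 0) * (p 0 * v t 1 - p 1 * v t 0)) / 12
  have hg : ∀ t ∈ Icc (0 : ℝ) 1, HasDerivAt (fun t => (p⁻¹ * y t) 3) (g' t) t := fun t ht => by
    have e : (fun t => (p⁻¹ * y t) 3) = fun t => (y t 3 - p 3) - (p 0 * y t 2 - p 2 * y t 0) / 2 +
        (p 0 + y t 0) * (p 0 * y t 1 - p 1 * y t 0) / 12 := by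
      funext t
      rw [mul_apply_three]
      simp only [inv_def, neg_apply]
      ring
    rw [e]
    have d0 := hyi t ht 0
    have d1 := hyi t ht 1
    have d2 := hyi t ht 2
    have d3 := hyi t ht 3
    exact ((d3.sub_const (p 3)).sub (((d2.const_mul (p 0)).sub (d0.const_mul (p 2))).div_const
      2)).add (((d0.const_add (p 0)).mul ((d1.const_mul (p 0)).sub (d0.const_mul (p 1)))).div_const
      12)
  have hbound : ∀ t ∈ Icc (0 : ℝ) 1, |g' t| ≤ (1 + M) ^ 4 * (‖h‖ * s) := fun t ht => by
    set z := p⁻¹ * y t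
    have hker : maurerCartan (y t) (v t) 3 = 0 := h3 _ (hmem t ht)
    have hz0 : z 0 = y t 0 - p 0 := inv_mul_apply_zero _ _
    have hz1 : z 1 = y t 1 - p 1 := inv_mul_apply_one _ _
    have hz2 : z 2 = y t 2 - p 2 - (p 0 * (y t 1 - p 1) - p 1 * (y t 0 - p 0)) / 2 :=
      inv_mul_apply_two _ _
    -- By left invariance, the vanishing `X₄` component of the velocity at `y t` can be read at `z =
    -- p⁻¹ * y t`, where it expresses `z₃'` through lower coordinates. Here `z 0`, `z 1` and `v t`
    -- are `O(‖h‖)`; `z 2` and its derivative `maurerCartan p (v t) 2` are `O(s)`, as the `X₃`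
    -- component vanishes at `u`. Every term is thus `O(‖h‖ * s)`.
    have hode : g' t = (z 0 * maurerCartan p (v t) 2 - z 2 * v t 0) / 2 -
        z 0 * (z 0 * v t 1 - z 1 * v t 0) / 6 := by
      rw [← sub_zero (g' t), ← hker, maurerCartan_two, maurerCartan_three, hz0, hz1, hz2]
      simp only [g']
      ring
    have hth' := (hth t ht).trans hh
    have b0 : |z 0| ≤ M * ‖h‖ := (hB.abs_inv_mul_zero_le hu hth').trans
      (mul_le_mul_of_nonneg_left (hth t ht) hM)
    have b1 : |z 1| ≤ M * ‖h‖ := (hB.abs_inv_mul_one_le hu hth').trans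
      (mul_le_mul_of_nonneg_left (hth t ht) hM)
    have hts : ‖t • h‖ ^ (α : ℝ) * ‖t • h‖ ≤ s := mul_le_mul
      (Real.rpow_le_rpow (norm_nonneg _) (hth t ht) α.2) (hth t ht) (norm_nonneg _) (by positivity)
    have b2 : |z 2| ≤ (1 + M) ^ 2 * M * s := by
      have := hB.abs_inv_mul_two_le hu hth'
      rw [h2, abs_zero, zero_add] at this
      exact this.trans (mul_le_mul_of_nonneg_left hts (by positivity))
    have bv : ‖v t‖ ≤ M * ‖h‖ :=
      ContinuousLinearMap.le_of_opNorm_le _ (hB.norm_fderiv_le _ (hmem t ht)) h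
    have bvi : ∀ i, |v t i| ≤ M * ‖h‖ := fun i => (abs_apply_le_norm _ _).trans bv
    have c2 : |maurerCartan p (v t) 2| ≤ (1 + M) ^ 2 * M * s := by
      have e : v t = fderiv ℝ φ u h + (fderiv ℝ φ (u + t • h) - fderiv ℝ φ u) h := by
        simp [v]
      rw [e, map_add, add_apply, h2, zero_add, mul_assoc]
      refine (abs_maurerCartan_le hp _ 2).trans (mul_le_mul_of_nonneg_left ?_ (by positivity))
      have hd := hB.norm_fderiv_sub_le _ (hmem t ht) u (hB.mem_closedBall hu)
      rw [add_sub_cancel_left] at hd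
      refine (ContinuousLinearMap.le_of_opNorm_le _ (hd.trans (mul_le_mul_of_nonneg_left
        (Real.rpow_le_rpow (norm_nonneg _) (hth t ht) α.2) hM)) h).trans (le_of_eq ?_)
      simp only [s]
      ring
    have hMh : 0 ≤ M * ‖h‖ := by positivity
    have hC : 0 ≤ (1 + M) ^ 2 * M * s := by positivity
    have e1 : |z 0 * maurerCartan p (v t) 2| ≤ M * ‖h‖ * ((1 + M) ^ 2 * M * s) := by
      rw [abs_mul]
      exact mul_le_mul b0 c2 (abs_nonneg _) hMh
    have e2 : |z 2 * v t 0| ≤ (1 + M) ^ 2 * M * s * (M * ‖h‖) := by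
      rw [abs_mul]
      exact mul_le_mul b2 (bvi 0) (abs_nonneg _) hC
    have e3 : |z 0 * v t 1 - z 1 * v t 0| ≤ 2 * (M * ‖h‖ * (M * ‖h‖)) := by
      refine (abs_sub _ _).trans ?_
      rw [abs_mul, abs_mul, two_mul]
      exact add_le_add (mul_le_mul b0 (bvi 1) (abs_nonneg _) hMh)
        (mul_le_mul b1 (bvi 0) (abs_nonneg _) hMh)
    have e4 : |z 0 * (z 0 * v t 1 - z 1 * v t 0)| ≤ M * ‖h‖ * (2 * (M * ‖h‖ * (M * ‖h‖))) := by
      rw [abs_mul]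
      exact mul_le_mul b0 e3 (abs_nonneg _) hMh
    have e5 : M * ‖h‖ * (2 * (M * ‖h‖ * (M * ‖h‖))) ≤ 2 * (M ^ 3 * (‖h‖ * s)) := by
      have : M ^ 3 * (‖h‖ * ‖h‖ ^ 2) ≤ M ^ 3 * (‖h‖ * s) := by gcongr
      linarith [this, (by ring : M * ‖h‖ * (2 * (M * ‖h‖ * (M * ‖h‖))) =
        2 * (M ^ 3 * (‖h‖ * ‖h‖ ^ 2)))]
    have hhs : 0 ≤ ‖h‖ * s := by positivity
    have hfin : |g' t| ≤ (M ^ 2 * (1 + M) ^ 2 + M ^ 3) * (‖h‖ * s) := by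
      have hM3 : 0 ≤ M ^ 3 * (‖h‖ * s) := by positivity
      have r1 : M * ‖h‖ * ((1 + M) ^ 2 * M * s) = M ^ 2 * (1 + M) ^ 2 * (‖h‖ * s) := by ring
      have r2 : (1 + M) ^ 2 * M * s * (M * ‖h‖) = M ^ 2 * (1 + M) ^ 2 * (‖h‖ * s) := by ring
      rw [r1] at e1
      rw [r2] at e2
      have e1 := abs_le.1 e1
      have e2 := abs_le.1 e2
      have e4 := abs_le.1 (e4.trans e5)
      rw [hode, abs_le, add_mul]
      constructor <;> linarith [e1.1, e1.2, e2.1, e2.2, e4.1, e4.2]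
    refine hfin.trans (mul_le_mul_of_nonneg_right ?_ hhs)
    have : 0 ≤ 1 + 4 * M + 5 * M ^ 2 + M ^ 3 := by positivity
    nlinarith
  have hmv := norm_image_sub_le_of_norm_deriv_le_segment_01' (f := fun t => (p⁻¹ * y t) 3)
    (fun t ht => (hg t ht).hasDerivWithinAt) (fun t ht => hbound t (Ico_subset_Icc_self ht))
  have hy0 : y 0 = p := by simp [y, p]
  have hy1 : y 1 = φ (u + h) := by simp [y]
  rw [hy0, hy1, inv_mul_cancel] at hmv
  simpa [one_def] using hmv

end HasHolderBounds

/-! ### Tangent planes of a parametrized surface -/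

section Tangent

variable {α : ℝ≥0} {S : Set EngelGroup} {U : Set (EuclideanSpace ℝ (Fin 2))}
  {φ : EuclideanSpace ℝ (Fin 2) → EngelGroup} {u : EuclideanSpace ℝ (Fin 2)}

theorem IsLocalParam.differentiableAt (hφ : IsLocalParam α S U φ) (hu : u ∈ U) :
    DifferentiableAt ℝ φ u :=
  (hφ.contDiffOn.differentiableOn one_ne_zero).differentiableAt (hφ.isOpen.mem_nhds hu)

theorem IsLocalParam.mem (hφ : IsLocalParam α S U φ) (hu : u ∈ U) : φ u ∈ S := by
  obtain ⟨V, -, hV⟩ := hφ.image_eq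
  exact (hV.subset (mem_image_of_mem φ hu)).1

theorem IsLocalParam.fderiv_mem_tangentSpace (hφ : IsLocalParam α S U φ) (hu : u ∈ U)
    (h : EuclideanSpace ℝ (Fin 2)) : fderiv ℝ φ u h ∈ tangentSpace S (φ u) := by
  have hline : HasDerivAt (fun t : ℝ => u + t • h) h 0 := by
    simpa using ((hasDerivAt_id (0 : ℝ)).smul_const h).const_add u
  refine ⟨fun t => φ (u + t • h), by simp, ?_, ?_⟩
  · have hU : U ∈ 𝓝 (u + (0 : ℝ) • h) := by simpa using hφ.isOpen.mem_nhds hu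
    exact (hline.continuousAt.eventually hU).mono fun t ht => hφ.mem ht
  · have : HasFDerivAt φ (fderiv ℝ φ u) (u + (0 : ℝ) • h) := by
      simpa using (hφ.differentiableAt hu).hasFDerivAt
    exact this.comp_hasDerivAt 0 hline

theorem IsLocalParam.linearIndependent (hφ : IsLocalParam α S U φ) (hu : u ∈ U) :
    LinearIndependent ℝ fun k => fderiv ℝ φ u (EuclideanSpace.basisFun (Fin 2) ℝ k) := by
  have := (EuclideanSpace.basisFun (Fin 2) ℝ).toBasis.linearIndependent.map'
    (fderiv ℝ φ u).toLinearMap (LinearMap.ker_eq_bot.2 (hφ.immersion u hu))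
  simpa [Function.comp_def] using this

theorem maurerCartan_fderiv_eq_zero {p : EngelGroup} {i : Fin 4}
    (hi : ∀ k, maurerCartan p (fderiv ℝ φ u (EuclideanSpace.basisFun (Fin 2) ℝ k)) i = 0)
    (h : EuclideanSpace ℝ (Fin 2)) : maurerCartan p (fderiv ℝ φ u h) i = 0 := by
  rw [← (EuclideanSpace.basisFun (Fin 2) ℝ).sum_repr h, map_sum, map_sum, Fin.sum_univ_two,
    add_apply, map_smul, map_smul, map_smul, map_smul, smul_apply, smul_apply, hi, hi]
  simp

theorem IsLocalParam.maurerCartan_three (hφ : IsLocalParam α S U φ) (hu : u ∈ U)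
    (hdeg : pointDegree S (φ u) ≤ 3) (h : EuclideanSpace ℝ (Fin 2)) :
    maurerCartan (φ u) (fderiv ℝ φ u h) 3 = 0 :=
  maurerCartan_fderiv_eq_zero (maurerCartan_three_eq_zero
    (fun _ => hφ.fderiv_mem_tangentSpace hu _) (hφ.linearIndependent hu) hdeg) h

theorem IsLocalParam.maurerCartan_two (hφ : IsLocalParam α S U φ) (hu : u ∈ U)
    (hdeg : pointDegree S (φ u) ≤ 2) (h : EuclideanSpace ℝ (Fin 2)) :
    maurerCartan (φ u) (fderiv ℝ φ u h) 2 = 0 :=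
  maurerCartan_fderiv_eq_zero (maurerCartan_two_eq_zero
    (fun _ => hφ.fderiv_mem_tangentSpace hu _) (hφ.linearIndependent hu) hdeg) h

theorem IsLocalParam.two_le_pointDegree (hφ : IsLocalParam α S U φ) (hu : u ∈ U) :
    2 ≤ pointDegree S (φ u) :=
  EngelGroup.two_le_pointDegree (fun _ => hφ.fderiv_mem_tangentSpace hu _)
    (hφ.linearIndependent hu)

end Tangent

/-! ### Negligibility in a chart, for degrees four and three -/

theorem volume_ge_of_slab (ℓ : EuclideanSpace ℝ (Fin 2) →ₗ[ℝ] ℝ) {K a b : ℝ} (hK : 0 ≤ K)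
    (hℓ : ∀ h, |ℓ h| ≤ K * ‖h‖) (ha : 0 < a) (hb : 0 < b) {u : EuclideanSpace ℝ (Fin 2)}
    {T : Set (EuclideanSpace ℝ (Fin 2))} (hT : ∀ h, ‖h‖ ≤ a → |ℓ h| ≤ b → u + h ∈ T) :
    ENNReal.ofReal (a ^ 2 / (4 * (K * a / b + 2))) ≤ volume T :=
  (volume_slab_ge ℓ hK hℓ ha hb).trans
    ((measure_mono fun h hh => hT h hh.1 hh.2).trans (measure_preimage_add volume u T).le)

theorem tendsto_rpow_nhdsGT_zero {β : ℝ} (hβ : 0 < β) :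
    Tendsto (fun r : ℝ => r ^ β) (𝓝[>] 0) (𝓝 0) := by
  have := (Real.continuousAt_rpow_const 0 β (Or.inr hβ.le)).tendsto
  rw [Real.zero_rpow hβ.ne'] at this
  exact this.mono_left nhdsWithin_le_nhds

theorem measurableSet_dist_le (hd : IsHomogeneousDist d)
    {φ : EuclideanSpace ℝ (Fin 2) → EngelGroup} {W : Set (EuclideanSpace ℝ (Fin 2))}
    (hW : IsClosed W) (hφ : ContinuousOn φ W) (p : EngelGroup) (r : ℝ) :
    MeasurableSet {u ∈ W | d p (φ u) ≤ r} := by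
  have hcl : IsClosed {q | d p q ≤ r} :=
    isClosed_le (hd.continuous.comp (Continuous.prodMk_right p)) continuous_const
  exact (hφ.preimage_isClosed_of_isClosed hW hcl).measurableSet

theorem rpow_mul_self_le {η r e : ℝ} {α : ℝ≥0} (hη : 0 ≤ η) (hr : 0 < r) (hle : η ≤ r ^ e) :
    η ^ (α : ℝ) * η ≤ r ^ (e * (1 + α)) := by
  calc η ^ (α : ℝ) * η ≤ (r ^ e) ^ (α : ℝ) * r ^ e :=
        mul_le_mul (Real.rpow_le_rpow hη hle α.2) hle hη (by positivity)
    _ = r ^ (e * (1 + α)) := by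
        rw [← Real.rpow_mul hr.le, ← Real.rpow_add hr]
        congr 1
        ring

variable {α : ℝ≥0} {S : Set EngelGroup} {U : Set (EuclideanSpace ℝ (Fin 2))}
  {φ : EuclideanSpace ℝ (Fin 2) → EngelGroup} {u₀ : EuclideanSpace ℝ (Fin 2)} {R M : ℝ}

theorem HasHolderBounds.continuousOn (hB : HasHolderBounds α φ u₀ R M) :
    ContinuousOn φ (Metric.closedBall u₀ (2 * R)) :=
  fun v hv => (hB.differentiableAt v hv).continuousAt.continuousWithinAt

theorem hasSmallCovers_four (hd : IsHomogeneousDist d) (hφ : IsLocalParam α S U φ)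
    (hU : Metric.closedBall u₀ (2 * R) ⊆ U) (hB : HasHolderBounds α φ u₀ R M)
    (hα : (1 / 2 : ℝ) < α) (hα₁ : α ≤ 1) :
    HasSmallCovers d 4 {p ∈ φ '' Metric.closedBall u₀ R | pointDegree S p ≤ 3} := by
  have hM := hB.nonneg
  have hα' : (α : ℝ) ≤ 1 := by exact_mod_cast hα₁
  obtain ⟨K, hK, hKd⟩ := hd.exists_le_of_abs_le ((1 + M) ^ 4)
  -- Chosen so that `‖h‖ ≤ r ^ e` gives `‖h‖^(1+α) ≤ r³`, the size allowed for the last coordinate.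
  set e : ℝ := 3 / (1 + α)
  have he1 : 1 ≤ e := by rw [le_div_iff₀ (by positivity)]; linarith
  have he2 : e < 2 := by rw [div_lt_iff₀ (by positivity)]; linarith
  have hmul : e * (1 + α) = (3 : ℕ) := by
    rw [div_mul_cancel₀ _ (by positivity)]; norm_num
  set L : ℝ := (1 + M) ^ 2 * M
  have hL : 0 ≤ L := by positivity
  have hM4 : L + 1 ≤ (1 + M) ^ 4 := by
    have : 0 ≤ 3 * M + 4 * M ^ 2 + 3 * M ^ 3 + M ^ 4 := by positivity
    simp only [L]
    nlinarith
  have hM1 : M ≤ (1 + M) ^ 4 := by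
    have : 0 ≤ 1 + 3 * M + 6 * M ^ 2 + 4 * M ^ 3 + M ^ 4 := by positivity
    nlinarith
  refine hasSmallCovers_of_measure hd volume (f := φ) (W := Metric.closedBall u₀ (2 * R))
    (m := fun r => (r ^ e) ^ 2 / (4 * (L * r ^ e / r ^ 2 + 2))) hK
    measure_closedBall_lt_top.ne
    (measurableSet_dist_le hd Metric.isClosed_closedBall hB.continuousOn)
    (fun r hr => by positivity) ?_ ?_
  · filter_upwards [Ioo_mem_nhdsGT hB.radius_pos] with r hr p hp
    obtain ⟨hr0, hrR⟩ := hr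
    obtain ⟨⟨u, hu, rfl⟩, hdeg⟩ := hp
    have har : r ^ e ≤ r := by
      simpa using Real.rpow_le_rpow_of_exponent_ge hr0 (hrR.le.trans hB.radius_le) he1
    have h3 := hφ.maurerCartan_three (hU (hB.mem_closedBall hu)) hdeg
    have hr32 : r ^ 3 ≤ r ^ 2 :=
      pow_le_pow_of_le_one hr0.le (hrR.le.trans hB.radius_le) (by norm_num)
    refine volume_ge_of_slab (u := u) ((LinearMap.proj (R := ℝ) (φ := fun _ : Fin 4 => ℝ) 2).comp
      ((maurerCartan (φ u)).comp (fderiv ℝ φ u).toLinearMap)) hL (fun h => ?_) (by positivity)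
      (by positivity) fun h hh hℓ => ?_
    · change |maurerCartan (φ u) (fderiv ℝ φ u h) 2| ≤ _
      refine (abs_maurerCartan_le (hB.norm_le u (hB.mem_closedBall hu)) _ 2).trans ?_
      rw [mul_assoc]
      exact mul_le_mul_of_nonneg_left (ContinuousLinearMap.le_of_opNorm_le _
        (hB.norm_fderiv_le u (hB.mem_closedBall hu)) h) (by positivity)
    · change |maurerCartan (φ u) (fderiv ℝ φ u h) 2| ≤ _ at hℓ
      have hhR : ‖h‖ ≤ R := hh.trans (har.trans hrR.le)
      have hs : ‖h‖ ^ (α : ℝ) * ‖h‖ ≤ r ^ 3 := by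
        have := rpow_mul_self_le (α := α) (norm_nonneg h) hr0 hh
        rwa [hmul, Real.rpow_natCast] at this
      refine ⟨hB.mem_closedBall_add hu hhR, hKd r hr0 _ _ fun i => ?_⟩
      have hMh : M * ‖h‖ ≤ (1 + M) ^ 4 * r ^ 1 := by
        rw [pow_one]
        exact mul_le_mul hM1 (hh.trans har) (norm_nonneg _) (by positivity)
      fin_cases i
      · exact (hB.abs_inv_mul_zero_le hu hhR).trans hMh
      · exact (hB.abs_inv_mul_one_le hu hhR).trans hMh
      · refine (hB.abs_inv_mul_two_le hu hhR).trans ?_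
        change _ ≤ (1 + M) ^ 4 * r ^ 2
        calc _ ≤ r ^ 2 + L * r ^ 2 :=
              add_le_add hℓ (mul_le_mul_of_nonneg_left (hs.trans hr32) hL)
          _ = (L + 1) * r ^ 2 := by ring
          _ ≤ (1 + M) ^ 4 * r ^ 2 := by gcongr
      · exact (hB.abs_inv_mul_three_le hα₁ hu hhR (h3 h)).trans
          (mul_le_mul_of_nonneg_left hs (by positivity))
  -- The ratio equals `4 L r^(2-e) + 8 (r^(2-e))²`.
  · have h0 := tendsto_rpow_nhdsGT_zero (sub_pos.2 he2)
    have hlim := (h0.const_mul (4 * L)).add ((h0.pow 2).const_mul 8)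
    rw [mul_zero, zero_pow two_ne_zero, mul_zero, add_zero] at hlim
    refine hlim.congr' ?_
    filter_upwards [self_mem_nhdsWithin] with r hr
    have hr : 0 < r := hr
    have ha : 0 < r ^ e := by positivity
    have e2 : r ^ (2 : ℝ) = r ^ 2 := Real.rpow_natCast r 2
    rw [Real.rpow_sub hr, e2]
    field_simp
    ring

theorem hasSmallCovers_three (hd : IsHomogeneousDist d) (hφ : IsLocalParam α S U φ)
    (hU : Metric.closedBall u₀ (2 * R) ⊆ U) (hB : HasHolderBounds α φ u₀ R M)
    (hdeg : ∀ p ∈ S, pointDegree S p ≤ 3) (hα : (1 / 3 : ℝ) < α) (hα₁ : α ≤ 1) :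
    HasSmallCovers d 3 {p ∈ φ '' Metric.closedBall u₀ R | pointDegree S p ≤ 2} := by
  have hM := hB.nonneg
  have hα' : (α : ℝ) ≤ 1 := by exact_mod_cast hα₁
  obtain ⟨K, hK, hKd⟩ := hd.exists_le_of_abs_le ((1 + M) ^ 4)
  -- Now only `‖h‖^(1+α) ≤ r²` is needed: the improved decay supplies the extra factor `‖h‖ ≤ r` in
  -- the last coordinate.
  set e : ℝ := 2 / (1 + α)
  have he1 : 1 ≤ e := by rw [le_div_iff₀ (by positivity)]; linarith
  have he2 : 2 * e < 3 := by
    rw [← mul_div_assoc, div_lt_iff₀ (by positivity)]; linarith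
  have hmul : e * (1 + α) = (2 : ℕ) := by
    rw [div_mul_cancel₀ _ (by positivity)]; norm_num
  have hM1 : M ≤ (1 + M) ^ 4 := by
    have : 0 ≤ 1 + 3 * M + 6 * M ^ 2 + 4 * M ^ 3 + M ^ 4 := by positivity
    nlinarith
  have hM2 : (1 + M) ^ 2 * M ≤ (1 + M) ^ 4 := by
    have : 0 ≤ 1 + 3 * M + 4 * M ^ 2 + 3 * M ^ 3 + M ^ 4 := by positivity
    nlinarith
  refine hasSmallCovers_of_measure hd volume (f := φ) (W := Metric.closedBall u₀ (2 * R))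
    -- The slab estimate with `ℓ = 0`, `K = 0`, `b = 1`: the slab is the whole disc, and `m r =
    -- r^(2e) / 8`.
    (m := fun r => (r ^ e) ^ 2 / (4 * (0 * r ^ e / 1 + 2))) hK
    measure_closedBall_lt_top.ne
    (measurableSet_dist_le hd Metric.isClosed_closedBall hB.continuousOn)
    (fun r hr => by positivity) ?_ ?_
  · filter_upwards [Ioo_mem_nhdsGT hB.radius_pos] with r hr p hp
    obtain ⟨hr0, hrR⟩ := hr
    obtain ⟨⟨u, hu, rfl⟩, hdeg₂⟩ := hp
    have har : r ^ e ≤ r := by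
      simpa using Real.rpow_le_rpow_of_exponent_ge hr0 (hrR.le.trans hB.radius_le) he1
    have h2 := hφ.maurerCartan_two (hU (hB.mem_closedBall hu)) hdeg₂
    refine volume_ge_of_slab (u := u) 0 le_rfl (fun h => by simp) (by positivity)
      one_pos fun h hh _ => ?_
    have hhR : ‖h‖ ≤ R := hh.trans (har.trans hrR.le)
    have h3 : ∀ v ∈ Metric.closedBall u₀ (2 * R), maurerCartan (φ v) (fderiv ℝ φ v h) 3 = 0 :=
      fun v hv => hφ.maurerCartan_three (hU hv) (hdeg _ (hφ.mem (hU hv))) h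
    have hs : ‖h‖ ^ (α : ℝ) * ‖h‖ ≤ r ^ 2 := by
      have := rpow_mul_self_le (α := α) (norm_nonneg h) hr0 hh
      rwa [hmul, Real.rpow_natCast] at this
    refine ⟨hB.mem_closedBall_add hu hhR, hKd r hr0 _ _ fun i => ?_⟩
    have hMh : M * ‖h‖ ≤ (1 + M) ^ 4 * r ^ 1 := by
      rw [pow_one]
      exact mul_le_mul hM1 (hh.trans har) (norm_nonneg _) (by positivity)
    fin_cases i
    · exact (hB.abs_inv_mul_zero_le hu hhR).trans hMh
    · exact (hB.abs_inv_mul_one_le hu hhR).trans hMh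
    · refine (hB.abs_inv_mul_two_le hu hhR).trans ?_
      rw [h2, abs_zero, zero_add]
      exact mul_le_mul hM2 hs (by positivity) (by positivity)
    · refine (hB.abs_inv_mul_three_le_of_horizontal hα₁ hu hhR h3 h2).trans
        (mul_le_mul_of_nonneg_left ?_ (by positivity))
      change _ ≤ r ^ 3
      rw [pow_succ' r 2]
      exact mul_le_mul (hh.trans har) hs (by positivity) hr0.le
  · have hlim := (tendsto_rpow_nhdsGT_zero (sub_pos.2 he2)).const_mul 8
    rw [mul_zero] at hlim
    refine hlim.congr' ?_
    filter_upwards [self_mem_nhdsWithin] with r hr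
    have hr : 0 < r := hr
    have ha : 0 < r ^ e := by positivity
    have e3 : r ^ (3 : ℝ) = r ^ 3 := Real.rpow_natCast r 3
    have e2 : r ^ (2 * e) = (r ^ e) ^ 2 := by
      rw [mul_comm, Real.rpow_mul hr.le]
      exact Real.rpow_natCast _ 2
    rw [Real.rpow_sub hr, e3, e2]
    field_simp
    ring

/-! ### From charts to the whole surface -/

theorem IsLocalParam.image_mem_nhdsWithin (hφ : IsLocalParam α S U φ) (hu₀ : u₀ ∈ U) (hR : 0 < R) :
    φ '' Metric.closedBall u₀ R ∈ 𝓝[S] (φ u₀) := by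
  obtain ⟨V, hVo, hV⟩ := hφ.image_eq
  have hopen : IsOpen (Subtype.val ⁻¹' Metric.ball u₀ R : Set U) :=
    Metric.isOpen_ball.preimage continuous_subtype_val
  obtain ⟨V', hV'o, hV'⟩ := hφ.isEmbedding.isInducing.isOpen_iff.1 hopen
  have hmemV : φ u₀ ∈ V := (hV.subset (mem_image_of_mem φ hu₀)).2
  have hiff : ∀ u ∈ U, φ u ∈ V' ↔ u ∈ Metric.ball u₀ R := fun u hu => by
    simpa only [mem_preimage, Set.domRestrict_apply] using Set.ext_iff.1 hV' ⟨u, hu⟩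
  have hmemV' : φ u₀ ∈ V' := (hiff u₀ hu₀).2 (Metric.mem_ball_self hR)
  refine mem_nhdsWithin.2 ⟨V ∩ V', hVo.inter hV'o, ⟨hmemV, hmemV'⟩, ?_⟩
  rintro q ⟨⟨hqV, hqV'⟩, hqS⟩
  obtain ⟨u, hu, rfl⟩ := hV.superset ⟨hqS, hqV⟩
  exact mem_image_of_mem φ (Metric.ball_subset_closedBall ((hiff u hu).1 hqV'))

/-- Negligibility of a part of a surface is a local property. -/
theorem hasSmallCovers_of_local {N : ℕ} (hS : IsC1HolderSurface α S) (P : EngelGroup → Prop)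
    (h : ∀ U φ u₀ R M, IsLocalParam α S U φ → Metric.closedBall u₀ (2 * R) ⊆ U →
      HasHolderBounds α φ u₀ R M → HasSmallCovers d N {p ∈ φ '' Metric.closedBall u₀ R | P p}) :
    HasSmallCovers d N {p ∈ S | P p} := by
  have hloc : ∀ p ∈ S, ∃ T ∈ 𝓝[S] p, HasSmallCovers d N {q ∈ T | P q} := by
    intro p hp
    obtain ⟨U, φ, hφ, u₀, hu₀, rfl⟩ := hS p hp
    obtain ⟨R, M, hU, hB⟩ := hφ.exists_hasHolderBounds hu₀
    exact ⟨_, hφ.image_mem_nhdsWithin hu₀ hB.radius_pos, h U φ u₀ R M hφ hU hB⟩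
  choose! T hT hcov using hloc
  -- Lindelöf: countably many chart pieces cover the surface.
  obtain ⟨t, htS, htc, ht⟩ := TopologicalSpace.countable_cover_nhdsWithin hT
  have := htc.to_subtype
  refine (hasSmallCovers_iUnion fun p : t => hcov p (htS p.2)).mono ?_
  rintro q ⟨hq, hPq⟩
  obtain ⟨p, hp, hqp⟩ := mem_iUnion₂.1 (ht hq)
  exact mem_iUnion.2 ⟨⟨p, hp⟩, hqp, hPq⟩

theorem lowDegreeSet_eq_empty (hS : IsC1HolderSurface α S) (hdeg : degree S ≤ 2) :
    lowDegreeSet S = ∅ := by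
  refine eq_empty_of_forall_notMem ?_
  rintro p ⟨hp, hlt⟩
  obtain ⟨U, φ, hφ, u, hu, rfl⟩ := hS p hp
  have := hφ.two_le_pointDegree hu
  omega

end EngelGroup

end

theorem mainTheorem6 (d : EngelGroup → EngelGroup → ℝ) (hd : EngelGroup.IsHomogeneousDist d)
    (S : Set EngelGroup) (α : ℝ≥0) (hS : EngelGroup.IsC1HolderSurface α S)
    (hdeg₂ : 2 ≤ EngelGroup.degree S) (hdeg₄ : EngelGroup.degree S ≤ 4)
    (hα : ((EngelGroup.degree S : ℝ) - 2) / (EngelGroup.degree S : ℝ) < (α : ℝ)) (hα₁ : α ≤ 1) :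
    EngelGroup.sphericalMeasure d (EngelGroup.degree S) (EngelGroup.lowDegreeSet S) = 0 := by
  open EngelGroup in
  refine HasSmallCovers.sphericalMeasure_eq_zero hd (by omega) ?_
  obtain h | h | h : degree S = 2 ∨ degree S = 3 ∨ degree S = 4 := by omega
  · rw [lowDegreeSet_eq_empty hS h.le]
    exact hasSmallCovers_empty _
  · have hα' : (1 / 3 : ℝ) < α := by
      rw [h] at hα
      norm_num at hα ⊢
      exact hα
    have hle : ∀ p ∈ S, pointDegree S p ≤ 3 := fun p hp => (pointDegree_le_degree hp).trans h.le
    rw [lowDegreeSet, h]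
    exact hasSmallCovers_of_local hS _ fun U φ u₀ R M hφ hU hB =>
      (hasSmallCovers_three hd hφ hU hB hle hα' hα₁).mono fun p hp => ⟨hp.1, Nat.le_of_lt_succ hp.2⟩
  · have hα' : (1 / 2 : ℝ) < α := by
      rw [h] at hα
      norm_num at hα ⊢
      exact hα
    rw [lowDegreeSet, h]
    exact hasSmallCovers_of_local hS _ fun U φ u₀ R M hφ hU hB =>
      (hasSmallCovers_four hd hφ hU hB hα' hα₁).mono fun p hp => ⟨hp.1, Nat.le_of_lt_succ hp.2⟩
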